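/- Every irrational number $x\in[0,1]$ has a unique infinite continued fraction expansion $$x=\cfrac{1}{a_1(x)+\cfrac{1}{a_2(x)+\cfrac{1}{a_3(x)+\ddots}}}$$ with positive integer partial quotients $a_n(x)$, $n\ge 1$. Let $\psi:\mathbb{N}\to\mathbb{N}$ satisfy $\psi(n)/n\to\infty$ as $n\to\infty$, and define $b$ and $B$ by $$\liminf_{n\to\infty}\frac{\log\psi(n)}{n}=\log b,\qquad \limsup_{n\to\infty}\frac{\log\psi(n)}{n}=\log B .$$ Assume that $b,B\in(1,\infty]$ (with $\log\infty=\infty$). Put $$\overline{E}(\psi)=\Big\{x\in[0,1]\setminus\mathbb{Q}:\ \limsup_{n\to\infty}\frac{\log a_1(x)+\cdots+\log a_n(x)}{\psi(n)}=1\Big\},$$ $$\underline{E}(\psi)=\Big\{x\in[0,1]\setminus\mathbb{Q}:\ \liminf_{n\to\infty}\frac{\log a_1(x)+\cdots+\log a_n(x)}{\psi(n)}=1\Big\}.$$ Then $$\dim_H\overline{E}(\psi)=\frac{1}{1+b}\qquad\text{and}\qquad \dim_H\underline{E}(\psi)=\frac{1}{1+B},$$ where $\dim_H$ denotes Hausdorff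 dimension and $1/(1+\infty)=0$. Moreover, both sets $\overline{E}(\psi)$ and $\underline{E}(\psi)$ are nonempty. -/

import Mathlib

noncomputable section

namespace FastKhintchine

/-- The Gauss transformation `T x = 1 / x (mod 1)`. Since `0⁻¹ = 0`, this includes `T 0 = 0`. -/
def gaussMap (x : ℝ) : ℝ := Int.fract x⁻¹

/-- The `n`-th partial quotient (`n ≥ 1`) of the continued fraction expansion
`x = [a₁(x), a₂(x), …]` of an irrational number `x ∈ (0, 1)`:
`a₁(x) = ⌊1 / x⌋` and `aₙ(x) = a₁(Tⁿ⁻¹ x)`. -/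
def partialQuotient (n : ℕ) (x : ℝ) : ℕ := ⌊(gaussMap^[n - 1] x)⁻¹⌋₊

/-- The sum `log a₁(x) + ⋯ + log aₙ(x)`. -/
def logSum (n : ℕ) (x : ℝ) : ℝ :=
  ∑ j ∈ Finset.Icc 1 n, Real.log (partialQuotient j x : ℝ)

/-- The irrational `x ∈ [0, 1]` with `limsup (log a₁(x) + ⋯ + log aₙ(x)) / ψ(n) = 1`. The upper
limit is taken in the extended reals. -/
def upperSet (ψ : ℕ → ℕ) : Set ℝ :=
  {x | x ∈ Set.Icc (0 : ℝ) 1 ∧ Irrational x ∧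
    Filter.limsup (fun n : ℕ => ((logSum n x / (ψ n : ℝ) : ℝ) : EReal)) Filter.atTop = 1}

/-- The irrational `x ∈ [0, 1]` with `liminf (log a₁(x) + ⋯ + log aₙ(x)) / ψ(n) = 1`. The lower
limit is taken in the extended reals. -/
def lowerSet (ψ : ℕ → ℕ) : Set ℝ :=
  {x | x ∈ Set.Icc (0 : ℝ) 1 ∧ Irrational x ∧
    Filter.liminf (fun n : ℕ => ((logSum n x / (ψ n : ℝ) : ℝ) : EReal)) Filter.atTop = 1}

end FastKhintchine

end

/-!
Write `Sₙ = log a₁ + ⋯ + log aₙ`.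

*Upper bounds.* A point of either set has `Sₙ > ψ(n) / 2` for infinitely many `n` with
`ψ(n) > dⁿ`, where `d` is any number below `b`, respectively `B`. So `Sₙ / cⁿ` is unbounded for
`c < d`, and it is enough to show that the set of such points has dimension at most `1 / (1 + c)`
(`dimH_unboundedSet_le`). At a new record of `Sₙ / cⁿ` both `Sₙ₊₁ ≥ c Sₙ` and `Sₙ₊₁ ≥ cⁿ⁺¹` hold.
The points with given `a₁, …, aₙ` where this happens form a set of diameter at most
`exp (-Sₙ - (1 - δ) c Sₙ - δ cⁿ⁺¹)` for all `δ ∈ [0, 1]`, and the sum of the `s`-th powers of these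
diameters over all `a₁, …, aₙ` is at most `zⁿ exp (-s δ cⁿ⁺¹)`, where
`z = ∑ₐ a ^ (-s (1 + (1 - δ) c))` is finite for `s > 1 / (1 + c)` and small `δ`. This is summable
over `n`.

*Lower bounds.* For a nondecreasing `L` with `L n / n → ∞`, restrict the digits to
`s j < a_{j+1} ≤ 2 s j` with `s j = ⌊exp (L (j + 1) - L j)⌋`. Then `Sₙ = L n + O(n)`. Reading the
`s j` possible digits as a mixed radix expansion maps this set onto `[0, 1)`, and if
`L (n + 1) ≤ c L n`, then this map is Hölder continuous of every exponent `t < 1 / (1 + c)`, so the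
set has dimension at least `1 / (1 + c)` (`le_dimH_digitSet`, `le_dimH_digitSet_digitBound`). For
the limit superior `L` is the largest nondecreasing minorant of `ψ` that grows at most by the
factor `c > b` in each step, and for the limit inferior the smallest such majorant, with `c > B`.
Both agree with `ψ` infinitely often (`exists_slow_minorant`, `exists_slow_majorant`), and `O(n)`
is negligible against `ψ(n)`. Without the growth restriction the same construction shows that the
sets are nonempty, also when `b` or `B` is infinite.
-/

noncomputable section

namespace FastKhintchine

/-! ### The Gauss map and partial quotients -/

lemma partialQuotient_succ (n : ℕ) (x : ℝ) :
    partialQuotient (n + 1) x = ⌊(gaussMap^[n] x)⁻¹⌋₊ := rfl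

@[simp] lemma logSum_zero (x : ℝ) : logSum 0 x = 0 := by simp [logSum]

lemma logSum_succ (n : ℕ) (x : ℝ) :
    logSum (n + 1) x = logSum n x + Real.log (partialQuotient (n + 1) x) := by
  rw [logSum, Finset.sum_Icc_succ_top (by omega), logSum]

lemma logSum_eq_sum_range (n : ℕ) (x : ℝ) :
    logSum n x = ∑ j ∈ Finset.range n, Real.log (partialQuotient (j + 1) x) := by
  induction n with
  | zero => simp
  | succ n ih => rw [logSum_succ, Finset.sum_range_succ, ih]

lemma irrational_gaussMap {x : ℝ} (hx : Irrational x) : Irrational (gaussMap x) := by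
  rw [gaussMap, ← Int.self_sub_floor]
  exact (irrational_inv_iff.2 hx).sub_intCast _

lemma gaussMap_mem_Ioo {x : ℝ} (hx : Irrational x) : gaussMap x ∈ Set.Ioo (0 : ℝ) 1 :=
  ⟨lt_of_le_of_ne (Int.fract_nonneg _) (irrational_gaussMap hx).ne_zero.symm, Int.fract_lt_one _⟩

lemma irrational_iterate_gaussMap {x : ℝ} (hx : Irrational x) (n : ℕ) :
    Irrational (gaussMap^[n] x) := by
  induction n with
  | zero => exact hx
  | succ n ih => rw [Function.iterate_succ_apply']; exact irrational_gaussMap ih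

lemma iterate_gaussMap_mem_Ioo {x : ℝ} (hx : Irrational x) (hx' : x ∈ Set.Icc (0 : ℝ) 1) (n : ℕ) :
    gaussMap^[n] x ∈ Set.Ioo (0 : ℝ) 1 := by
  cases n with
  | zero => exact ⟨lt_of_le_of_ne hx'.1 hx.ne_zero.symm, lt_of_le_of_ne hx'.2 hx.ne_one⟩
  | succ n =>
    rw [Function.iterate_succ_apply']
    exact gaussMap_mem_Ioo (irrational_iterate_gaussMap hx n)

/-- `1 / x = a₁(x) + T x`. -/
lemma inv_eq_floor_add_gaussMap {x : ℝ} (hx : 0 < x) : x⁻¹ = (⌊x⁻¹⌋₊ : ℝ) + gaussMap x := by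
  rw [gaussMap, natCast_floor_eq_intCast_floor (inv_pos.2 hx).le, Int.floor_add_fract]

lemma one_le_partialQuotient {x : ℝ} (hx : Irrational x) (hx' : x ∈ Set.Icc (0 : ℝ) 1) (n : ℕ) :
    1 ≤ partialQuotient (n + 1) x := by
  have h := iterate_gaussMap_mem_Ioo hx hx' n
  rw [partialQuotient_succ, Nat.one_le_floor_iff]
  exact (one_le_inv₀ h.1).2 h.2.le

lemma logSum_nonneg (n : ℕ) (x : ℝ) : 0 ≤ logSum n x :=
  Finset.sum_nonneg fun _ _ => Real.log_natCast_nonneg _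

lemma iterate_gaussMap_eq {x : ℝ} (hx : Irrational x) (hx' : x ∈ Set.Icc (0 : ℝ) 1) (n : ℕ) :
    gaussMap^[n] x = ((partialQuotient (n + 1) x : ℝ) + gaussMap^[n + 1] x)⁻¹ := by
  rw [partialQuotient_succ, Function.iterate_succ_apply',
    ← inv_eq_floor_add_gaussMap (iterate_gaussMap_mem_Ioo hx hx' n).1, inv_inv]

lemma iterate_gaussMap_le {x : ℝ} (hx : Irrational x) (hx' : x ∈ Set.Icc (0 : ℝ) 1) (n : ℕ) :
    gaussMap^[n] x ≤ (partialQuotient (n + 1) x : ℝ)⁻¹ := by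
  have h1 : (1 : ℝ) ≤ partialQuotient (n + 1) x := by exact_mod_cast one_le_partialQuotient hx hx' n
  rw [iterate_gaussMap_eq hx hx' n]
  exact inv_anti₀ (by linarith) (by linarith [(iterate_gaussMap_mem_Ioo hx hx' (n + 1)).1])

lemma le_iterate_gaussMap {x : ℝ} (hx : Irrational x) (hx' : x ∈ Set.Icc (0 : ℝ) 1) (n : ℕ) :
    ((partialQuotient (n + 1) x : ℝ) + 1)⁻¹ ≤ gaussMap^[n] x := by
  have h1 : (1 : ℝ) ≤ partialQuotient (n + 1) x := by exact_mod_cast one_le_partialQuotient hx hx' n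
  have h2 := iterate_gaussMap_mem_Ioo hx hx' (n + 1)
  rw [iterate_gaussMap_eq hx hx' n]
  exact inv_anti₀ (by linarith [h2.1]) (by linarith [h2.2])

lemma abs_iterate_sub {x y : ℝ} (hx : Irrational x) (hx' : x ∈ Set.Icc (0 : ℝ) 1)
    (hy : Irrational y) (hy' : y ∈ Set.Icc (0 : ℝ) 1) (n : ℕ) :
    |gaussMap^[n] x - gaussMap^[n] y| =
      |((partialQuotient (n + 1) x : ℝ) + gaussMap^[n + 1] x) -
        ((partialQuotient (n + 1) y : ℝ) + gaussMap^[n + 1] y)| *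
        (gaussMap^[n] x * gaussMap^[n] y) := by
  have hx0 := (iterate_gaussMap_mem_Ioo hx hx' n).1
  have hy0 := (iterate_gaussMap_mem_Ioo hy hy' n).1
  have e1 : (partialQuotient (n + 1) x : ℝ) + gaussMap^[n + 1] x = (gaussMap^[n] x)⁻¹ := by
    rw [iterate_gaussMap_eq hx hx' n, inv_inv]
  have e2 : (partialQuotient (n + 1) y : ℝ) + gaussMap^[n + 1] y = (gaussMap^[n] y)⁻¹ := by
    rw [iterate_gaussMap_eq hy hy' n, inv_inv]
  have e : gaussMap^[n] y - gaussMap^[n] x =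
      ((gaussMap^[n] x)⁻¹ - (gaussMap^[n] y)⁻¹) * (gaussMap^[n] x * gaussMap^[n] y) := by
    field_simp
  rw [e1, e2, abs_sub_comm, e, abs_mul, abs_of_pos (mul_pos hx0 hy0)]

lemma abs_sub_le_of_partialQuotient_eq {x y : ℝ} (hx : Irrational x)
    (hx' : x ∈ Set.Icc (0 : ℝ) 1) (hy : Irrational y) (hy' : y ∈ Set.Icc (0 : ℝ) 1) (n : ℕ)
    (h : ∀ j < n, partialQuotient (j + 1) x = partialQuotient (j + 1) y) :
    |x - y| ≤ |gaussMap^[n] x - gaussMap^[n] y| * Real.exp (-2 * logSum n x) := by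
  induction n with
  | zero => simp
  | succ n ih =>
    refine (ih fun j hj => h j (by omega)).trans ?_
    rw [abs_iterate_sub hx hx' hy hy' n, ← h n (by omega), add_sub_add_left_eq_sub, mul_assoc,
      logSum_succ]
    refine mul_le_mul_of_nonneg_left ?_ (abs_nonneg _)
    have h1 : (1 : ℝ) ≤ partialQuotient (n + 1) x := by
      exact_mod_cast one_le_partialQuotient hx hx' n
    have hx1 := iterate_gaussMap_le hx hx' n
    have hy1 := iterate_gaussMap_le hy hy' n
    rw [← h n (by omega)] at hy1
    have e : Real.exp (-2 * (logSum n x + Real.log (partialQuotient (n + 1) x))) =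
        ((partialQuotient (n + 1) x : ℝ)⁻¹ * (partialQuotient (n + 1) x : ℝ)⁻¹) *
          Real.exp (-2 * logSum n x) := by
      have : Real.exp (- Real.log (partialQuotient (n + 1) x : ℝ)) =
          (partialQuotient (n + 1) x : ℝ)⁻¹ := by
        rw [Real.exp_neg, Real.exp_log (by linarith)]
      rw [← this, ← Real.exp_add, ← Real.exp_add]
      congr 1
      ring
    rw [e]
    refine mul_le_mul_of_nonneg_right ?_ (Real.exp_pos _).le
    exact mul_le_mul hx1 hy1 (iterate_gaussMap_mem_Ioo hy hy' n).1.le (by positivity)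

lemma le_abs_sub_of_partialQuotient_eq {x y : ℝ} (hx : Irrational x)
    (hx' : x ∈ Set.Icc (0 : ℝ) 1) (hy : Irrational y) (hy' : y ∈ Set.Icc (0 : ℝ) 1) (n : ℕ)
    (h : ∀ j < n, partialQuotient (j + 1) x = partialQuotient (j + 1) y) :
    |gaussMap^[n] x - gaussMap^[n] y| *
      ∏ j ∈ Finset.range n, (((partialQuotient (j + 1) x : ℝ) + 1) ^ 2)⁻¹ ≤ |x - y| := by
  induction n with
  | zero => simp
  | succ n ih =>
    refine le_trans ?_ (ih fun j hj => h j (by omega))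
    rw [abs_iterate_sub hx hx' hy hy' n, ← h n (by omega), add_sub_add_left_eq_sub, mul_assoc,
      Finset.prod_range_succ, mul_comm (∏ j ∈ Finset.range n, _)]
    refine mul_le_mul_of_nonneg_left (mul_le_mul_of_nonneg_right ?_ (by positivity)) (abs_nonneg _)
    have hx1 := le_iterate_gaussMap hx hx' n
    have hy1 := le_iterate_gaussMap hy hy' n
    rw [← h n (by omega)] at hy1
    rw [pow_two, mul_inv]
    exact mul_le_mul hx1 hy1 (by positivity) (iterate_gaussMap_mem_Ioo hx hx' n).1.le

/-! ### Irrational numbers with prescribed partial quotients -/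

/-- An infinite Gauss orbit in `(0, ∞)` cannot start at a rational number, since the numerators
along the orbit of a rational number decrease strictly. -/
lemma irrational_of_iterate_gaussMap_pos {x : ℝ} (h : ∀ n, 0 < gaussMap^[n] x) : Irrational x := by
  have key : ∀ N : ℕ, ∀ n : ℕ, ∀ q : ℚ, (q : ℝ) = gaussMap^[n] x → q.num ≤ N → False := by
    intro N
    induction N with
    | zero =>
      intro n q hq hN
      have hq0 : 0 < q := by have := h n; rw [← hq] at this; exact_mod_cast this
      have := Rat.num_pos.2 hq0
      omega
    | succ N ih =>
      intro n q hq hN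
      have hq0 : 0 < q := by have := h n; rw [← hq] at this; exact_mod_cast this
      have hlt := Rat.fract_inv_num_lt_num_of_pos hq0
      refine ih (n + 1) (Int.fract q⁻¹) ?_ (by push_cast at hN; omega)
      rw [Function.iterate_succ_apply', ← hq, Rat.cast_fract, Rat.cast_inv, gaussMap]
  rintro ⟨q, hq⟩
  exact key q.num.natAbs 0 q hq (by omega)

/-- Every sequence of positive integers is the sequence of partial quotients of an irrational
number. The whole Gauss orbit `t` of that number is found at once, by compactness of `[0, 1]^ℕ`,
as a solution of `t n * (a n + t (n + 1)) = 1`. -/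
lemma exists_partialQuotient_eq (a : ℕ → ℕ) (ha : ∀ j, 1 ≤ a j) :
    ∃ x ∈ Set.Icc (0 : ℝ) 1, Irrational x ∧ ∀ j, partialQuotient (j + 1) x = a j := by
  have ha' : ∀ j, (1 : ℝ) ≤ a j := fun j => by exact_mod_cast ha j
  obtain ⟨t, ht⟩ : ∃ t : ℕ → ℝ, (∀ n, t n ∈ Set.Icc (0 : ℝ) 1) ∧
      ∀ n, t n * (a n + t (n + 1)) = 1 := by
    let K : ℕ → Set (ℕ → ℝ) := fun N =>
      Set.univ.pi (fun _ => Set.Icc (0 : ℝ) 1) ∩ {t | ∀ n < N, t n * (a n + t (n + 1)) = 1}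
    have hclosed : ∀ N, IsClosed (K N) := by
      intro N
      refine (isClosed_set_pi fun _ _ => isClosed_Icc).inter ?_
      simp only [Set.ofPred_forall]
      refine isClosed_iInter fun n => isClosed_iInter fun _ => ?_
      exact isClosed_eq (by fun_prop) continuous_const
    have hne : ∀ N, (K N).Nonempty := by
      intro N
      -- Starting from an arbitrary tail, the first `m` equations are solved backwards.
      have : ∀ m ≤ N, ∃ t : ℕ → ℝ, (∀ n, t n ∈ Set.Icc (0 : ℝ) 1) ∧
          ∀ n < N, N - m ≤ n → t n * (a n + t (n + 1)) = 1 := by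
        intro m
        induction m with
        | zero => exact fun _ => ⟨fun _ => 0, fun _ => by simp, fun n h1 h2 => by omega⟩
        | succ m ih =>
          intro hm
          obtain ⟨t, ht1, ht2⟩ := ih (by omega)
          have hpos : 1 ≤ (a (N - (m + 1)) : ℝ) + t (N - m) := by
            linarith [ha' (N - (m + 1)), (ht1 (N - m)).1]
          refine ⟨Function.update t (N - (m + 1)) ((a (N - (m + 1)) + t (N - m)))⁻¹, ?_, ?_⟩
          · intro n
            rcases eq_or_ne n (N - (m + 1)) with rfl | hn
            · rw [Function.update_self]
              exact ⟨by positivity, inv_le_one_of_one_le₀ hpos⟩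
            · rw [Function.update_of_ne hn]; exact ht1 n
          · intro n h1 h2
            rw [Function.update_of_ne (show n + 1 ≠ N - (m + 1) by omega)]
            rcases eq_or_ne n (N - (m + 1)) with rfl | hn
            · rw [Function.update_self, show N - (m + 1) + 1 = N - m by omega]
              exact inv_mul_cancel₀ (by positivity)
            · rw [Function.update_of_ne hn]; exact ht2 n h1 (by omega)
      obtain ⟨t, ht1, ht2⟩ := this N le_rfl
      exact ⟨t, fun n _ => ht1 n, fun n hn => ht2 n hn (by omega)⟩
    obtain ⟨t, ht⟩ := IsCompact.nonempty_iInter_of_sequence_nonempty_isCompact_isClosed K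
      (fun N => Set.inter_subset_inter_right _ fun t ht n hn => ht n (by omega)) hne
      ((isCompact_univ_pi fun _ => isCompact_Icc).of_isClosed_subset (hclosed 0)
        Set.inter_subset_left) hclosed
    rw [Set.mem_iInter] at ht
    exact ⟨t, fun n => (ht 0).1 n trivial, fun n => (ht (n + 1)).2 n (by omega)⟩
  obtain ⟨ht1, ht2⟩ := ht
  have hpos : ∀ n, 0 < t n := fun n => lt_of_le_of_ne (ht1 n).1 fun h => by
    have := ht2 n; rw [← h] at this; simp at this
  have hinv : ∀ n, (t n)⁻¹ = a n + t (n + 1) := fun n =>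
    inv_eq_of_mul_eq_one_right (ht2 n)
  have hlt : ∀ n, t n < 1 := fun n => by
    have h1 : 1 < (t n)⁻¹ := by rw [hinv]; linarith [ha' n, hpos (n + 1)]
    exact (one_lt_inv₀ (hpos n)).1 h1
  have hiter : ∀ n, gaussMap^[n] (t 0) = t n := by
    intro n
    induction n with
    | zero => rfl
    | succ n ih =>
      rw [Function.iterate_succ_apply', ih, gaussMap, hinv, Int.fract_natCast_add]
      exact Int.fract_eq_self.2 ⟨(hpos _).le, hlt _⟩
  refine ⟨t 0, ht1 0, irrational_of_iterate_gaussMap_pos fun n => by rw [hiter]; exact hpos n, ?_⟩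
  intro j
  rw [partialQuotient_succ, hiter, hinv, Nat.floor_eq_iff (by have := hpos (j + 1); positivity)]
  exact ⟨by linarith [hpos (j + 1)], by linarith [hlt (j + 1)]⟩

/-! ### The upper bound -/

lemma tsum_fin_prod (g : ℕ → ENNReal) (n : ℕ) :
    ∑' k : Fin n → ℕ, ∏ j, g (k j) = (∑' k, g k) ^ n := by
  induction n with
  | zero => simp
  | succ n ih =>
    rw [← (Fin.consEquiv (fun _ : Fin (n + 1) => ℕ)).tsum_eq, pow_succ', ← ih]
    simp only [Fin.consEquiv_apply, Fin.prod_univ_succ, Fin.cons_zero, Fin.cons_succ]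
    rw [ENNReal.tsum_prod (f := fun a (b : Fin n → ℕ) => g a * ∏ j, g (b j))]
    simp_rw [ENNReal.tsum_mul_left, ENNReal.tsum_mul_right]

lemma summable_pow_mul_exp_neg_pow {c : ℝ} (hc : 1 < c) {γ : ℝ} (hγ : 0 < γ) {z : ℝ} (hz : 0 < z) :
    Summable fun n : ℕ => z ^ n * Real.exp (-(γ * c ^ (n + 1))) := by
  have hlim : Filter.Tendsto (fun n : ℕ => (n : ℝ) / c ^ n) Filter.atTop (nhds 0) := by
    simpa using tendsto_pow_const_div_const_pow_of_one_lt 1 hc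
  have hev : ∀ᶠ n : ℕ in Filter.atTop, (n : ℝ) / c ^ n < γ / (|Real.log z| + 1) :=
    hlim.eventually_lt_const (by positivity)
  have hsum : Summable fun n : ℕ => Real.exp (-1) ^ n :=
    summable_geometric_of_lt_one (Real.exp_pos _).le (by simp)
  refine Summable.of_norm_bounded_eventually_nat hsum ?_
  filter_upwards [hev] with n hn
  have hcn : 0 < c ^ n := by positivity
  rw [div_lt_div_iff₀ hcn (by positivity)] at hn
  rw [Real.norm_of_nonneg (by positivity), ← Real.exp_nat_mul]
  nth_rewrite 1 [← Real.exp_log hz]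
  rw [← Real.exp_nat_mul, ← Real.exp_add]
  refine Real.exp_le_exp.2 ?_
  have h1 : (n : ℝ) * Real.log z ≤ n * |Real.log z| :=
    mul_le_mul_of_nonneg_left (le_abs_self _) (by positivity)
  have h2 : γ * c ^ n ≤ γ * c ^ (n + 1) := by
    rw [pow_succ]; nlinarith [mul_pos hγ hcn]
  nlinarith

/-- The irrational `x ∈ [0, 1]` for which `(log a₁(x) + ⋯ + log aₙ(x)) / cⁿ` is unbounded. -/
def unboundedSet (c : ℝ) : Set ℝ :=
  {x | x ∈ Set.Icc (0 : ℝ) 1 ∧ Irrational x ∧ ∀ M : ℝ, ∃ n, M * c ^ n < logSum n x}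

/-- The points whose first `n` partial quotients are `k j + 1` and at which the sum of logarithms
makes a large jump in step `n + 1`. -/
def jumpSet (c : ℝ) (n : ℕ) (k : Fin n → ℕ) : Set ℝ :=
  {x | x ∈ Set.Icc (0 : ℝ) 1 ∧ Irrational x ∧ (∀ j : Fin n, partialQuotient (j + 1) x = k j + 1) ∧
    c * logSum n x ≤ logSum (n + 1) x ∧ c ^ (n + 1) ≤ logSum (n + 1) x}

/-- At a new record of `logSum n x / c ^ n` the sum jumps, and records occur infinitely often. -/
lemma exists_mem_jumpSet {c : ℝ} (hc : 1 < c) {x : ℝ} (hx : x ∈ unboundedSet c) (N : ℕ) :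
    ∃ n, N ≤ n ∧ ∃ k, x ∈ jumpSet c n k := by
  obtain ⟨hx', hirr, hM⟩ := hx
  have hc0 : 0 < c := by linarith
  obtain ⟨M, hM1, hMN⟩ : ∃ M : ℝ, 1 ≤ M ∧ ∀ n ≤ N, logSum n x ≤ M * c ^ n := by
    refine ⟨1 + ∑ n ∈ Finset.range (N + 1), logSum n x, ?_, fun n hn => ?_⟩
    · have := Finset.sum_nonneg fun n (_ : n ∈ Finset.range (N + 1)) => logSum_nonneg n x
      linarith
    · have h1 := Finset.single_le_sum (f := fun n => logSum n x)
        (fun n _ => logSum_nonneg n x) (Finset.mem_range.2 (Nat.lt_succ_of_le hn))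
      have h2 : 1 ≤ c ^ n := one_le_pow₀ hc.le
      have h3 := logSum_nonneg n x
      nlinarith
  classical
  have hfind := Nat.find_spec (hM M)
  have hlt : N < Nat.find (hM M) := by
    by_contra h
    linarith [hMN _ (not_lt.1 h)]
  obtain ⟨n, hn⟩ : ∃ n, Nat.find (hM M) = n + 1 := ⟨Nat.find (hM M) - 1, by omega⟩
  have hmin : logSum n x ≤ M * c ^ n := not_lt.1 (Nat.find_min (hM M) (by omega))
  rw [hn] at hfind
  refine ⟨n, by omega, fun j => partialQuotient (j + 1) x - 1, hx', hirr, fun j => ?_, ?_, ?_⟩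
  · exact (Nat.sub_add_cancel (one_le_partialQuotient hirr hx' j)).symm
  · rw [pow_succ] at hfind
    nlinarith
  · have : 0 < c ^ (n + 1) := by positivity
    nlinarith

lemma logSum_of_mem_jumpSet {c : ℝ} {n : ℕ} {k : Fin n → ℕ} {x : ℝ} (hx : x ∈ jumpSet c n k) :
    logSum n x = ∑ j, Real.log ((k j : ℝ) + 1) := by
  rw [logSum_eq_sum_range, Finset.sum_range]
  refine Finset.sum_congr rfl fun j _ => ?_
  rw [hx.2.2.1 j]
  push_cast
  rfl

/-- The jump is split with weights `1 - δ` and `δ` between its two lower bounds: the first part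
makes the sum over all `k` converge, the second makes it small. -/
lemma dist_le_of_mem_jumpSet {c δ : ℝ} (hδ : 0 ≤ δ) (hδ1 : δ ≤ 1) {n : ℕ}
    {k : Fin n → ℕ} {x y : ℝ} (hx : x ∈ jumpSet c n k) (hy : y ∈ jumpSet c n k) :
    dist x y ≤ Real.exp (-((1 + (1 - δ) * c) * ∑ j, Real.log ((k j : ℝ) + 1)) -
      δ * c ^ (n + 1)) := by
  have hLx := logSum_of_mem_jumpSet hx
  set L := ∑ j, Real.log ((k j : ℝ) + 1)
  have orbit : ∀ z ∈ jumpSet c n k, 0 < gaussMap^[n] z ∧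
      gaussMap^[n] z ≤ Real.exp (L - (1 - δ) * (c * L) - δ * c ^ (n + 1)) := by
    intro z hz
    refine ⟨(iterate_gaussMap_mem_Ioo hz.2.1 hz.1 n).1,
      (iterate_gaussMap_le hz.2.1 hz.1 n).trans ?_⟩
    have hLz := logSum_of_mem_jumpSet hz
    have h1 : (0 : ℝ) < partialQuotient (n + 1) z := by
      exact_mod_cast one_le_partialQuotient hz.2.1 hz.1 n
    rw [← Real.exp_log h1, ← Real.exp_neg]
    refine Real.exp_le_exp.2 ?_
    have h2 := logSum_succ n z
    have h3 := hz.2.2.2.1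
    have h4 := hz.2.2.2.2
    rw [hLz] at h2 h3
    nlinarith
  obtain ⟨hx0, hx1⟩ := orbit x hx
  obtain ⟨hy0, hy1⟩ := orbit y hy
  have hdist := abs_sub_le_of_partialQuotient_eq hx.2.1 hx.1 hy.2.1 hy.1 n fun j hj =>
    (hx.2.2.1 ⟨j, hj⟩).trans (hy.2.2.1 ⟨j, hj⟩).symm
  rw [hLx] at hdist
  rw [Real.dist_eq]
  refine hdist.trans ((mul_le_mul_of_nonneg_right
    (abs_sub_le_of_nonneg_of_le hx0.le hx1 hy0.le hy1) (Real.exp_pos _).le).trans ?_)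
  rw [← Real.exp_add]
  exact Real.exp_le_exp.2 (by linarith)

lemma hausdorffMeasure_unboundedSet {c : ℝ} (hc : 1 < c) {s : ℝ} (hs : 1 < s * (1 + c)) :
    MeasureTheory.Measure.hausdorffMeasure s (unboundedSet c) = 0 := by
  have hc0 : 0 < c := by linarith
  have hs0 : 0 < s := pos_of_mul_pos_left (by linarith : 0 < s * (1 + c)) (by linarith)
  obtain ⟨δ, hδ, hδ1, hτ⟩ : ∃ δ : ℝ, 0 < δ ∧ δ ≤ 1 ∧ 1 < s * (1 + (1 - δ) * c) := by
    have hsc : 0 < s * c := by positivity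
    refine ⟨min 1 ((s * (1 + c) - 1) / (2 * (s * c))), ?_, min_le_left _ _, ?_⟩
    · exact lt_min one_pos (div_pos (by linarith) (by linarith))
    · have h := min_le_right 1 ((s * (1 + c) - 1) / (2 * (s * c)))
      rw [le_div_iff₀ (by linarith)] at h
      nlinarith
  set τ := s * (1 + (1 - δ) * c)
  set g : ℕ → ENNReal := fun k => ENNReal.ofReal (Real.exp (-(τ * Real.log ((k : ℝ) + 1))))
  set e : ℕ → ENNReal := fun n => ENNReal.ofReal (Real.exp (-(s * δ * c ^ (n + 1))))
  have hdiam : ∀ n k, Metric.ediam (jumpSet c n k) ≤ ENNReal.ofReal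
      (Real.exp (-((1 + (1 - δ) * c) * ∑ j, Real.log ((k j : ℝ) + 1)) - δ * c ^ (n + 1))) :=
    fun n k => Metric.ediam_le fun x hx y hy => by
      rw [edist_dist]
      exact ENNReal.ofReal_le_ofReal (dist_le_of_mem_jumpSet hδ.le hδ1 hx hy)
  have hpow : ∀ n k, Metric.ediam (jumpSet c n k) ^ s ≤ (∏ j, g (k j)) * e n := by
    intro n k
    refine (ENNReal.rpow_le_rpow (hdiam n k) hs0.le).trans (le_of_eq ?_)
    rw [ENNReal.ofReal_rpow_of_pos (Real.exp_pos _), ← Real.exp_mul,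
      ← ENNReal.ofReal_prod_of_nonneg (fun _ _ => (Real.exp_pos _).le), ← Real.exp_sum,
      ← ENNReal.ofReal_mul (Real.exp_pos _).le, ← Real.exp_add]
    congr 2
    rw [Finset.sum_neg_distrib, ← Finset.mul_sum]
    simp only [τ]
    ring
  have hZ : ∑' k, g k ≠ ⊤ := by
    have h1 : Summable fun k : ℕ => Real.exp (-(τ * Real.log ((k : ℝ) + 1))) := by
      have h2 := (summable_nat_add_iff 1).2 (Real.summable_nat_rpow_inv.2 hτ)
      refine h2.congr fun k => ?_
      rw [← Real.rpow_neg (by positivity), Real.rpow_def_of_pos (by positivity)]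
      push_cast
      congr 1
      ring
    exact h1.tsum_ofReal_ne_top
  have hsum : ∑' n, (∑' k, g k) ^ n * e n ≠ ⊤ := by
    have h1 := (summable_pow_mul_exp_neg_pow hc (γ := s * δ) (by positivity)
      (z := (∑' k, g k).toReal + 1) (by positivity)).tsum_ofReal_ne_top
    refine ne_top_of_le_ne_top h1 (ENNReal.tsum_le_tsum fun n => ?_)
    rw [ENNReal.ofReal_mul (by positivity), ENNReal.ofReal_pow (by positivity)]
    gcongr
    rw [ENNReal.le_ofReal_iff_toReal_le hZ (by positivity)]
    linarith
  have hr : Filter.Tendsto (fun N : ℕ => ENNReal.ofReal (Real.exp (-(δ * c ^ N))))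
      Filter.atTop (nhds 0) := by
    rw [← ENNReal.ofReal_zero]
    refine ENNReal.tendsto_ofReal (Real.tendsto_exp_atBot.comp
      (Filter.tendsto_neg_atTop_atBot.comp ?_))
    exact (tendsto_pow_atTop_atTop_of_one_lt hc).const_mul_atTop hδ
  refine le_antisymm ?_ zero_le
  refine (MeasureTheory.Measure.hausdorffMeasure_le_liminf_tsum
    (ι := fun N : ℕ => Σ n : ℕ, (Fin (n + N) → ℕ)) s (unboundedSet c) _ hr
    (fun N p => jumpSet c (p.1 + N) p.2) (.of_forall fun N p => ?_)
    (.of_forall fun N x hx => ?_)).trans ?_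
  · refine (hdiam _ _).trans (ENNReal.ofReal_le_ofReal (Real.exp_le_exp.2 ?_))
    have h1 : 0 ≤ ∑ j, Real.log ((p.2 j : ℝ) + 1) := Finset.sum_nonneg fun j _ =>
      Real.log_nonneg (by linarith [Nat.cast_nonneg (α := ℝ) (p.2 j)])
    have h2 : c ^ N ≤ c ^ (p.1 + N + 1) := pow_le_pow_right₀ hc.le (by omega)
    have h3 : 0 ≤ (1 - δ) * c := mul_nonneg (by linarith) hc0.le
    nlinarith [mul_nonneg (add_nonneg zero_le_one h3) h1]
  · obtain ⟨n, hn, k, hk⟩ := exists_mem_jumpSet hc hx N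
    obtain ⟨m, rfl⟩ := Nat.exists_eq_add_of_le' hn
    exact Set.mem_iUnion.2 ⟨⟨m, k⟩, hk⟩
  · rw [← (ENNReal.tendsto_sum_nat_add _ hsum).liminf_eq]
    refine Filter.liminf_le_liminf (.of_forall fun N => ?_)
    rw [ENNReal.tsum_sigma']
    refine ENNReal.tsum_le_tsum fun n => ?_
    rw [← tsum_fin_prod, ← ENNReal.tsum_mul_right]
    exact ENNReal.tsum_le_tsum fun k => hpow _ _

lemma dimH_unboundedSet_le {c : ℝ} (hc : 1 < c) :
    dimH (unboundedSet c) ≤ (1 + ENNReal.ofReal c)⁻¹ := by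
  refine dimH_le fun s hs => ?_
  by_contra hlt
  rw [not_le, ENNReal.inv_lt_iff_inv_lt] at hlt
  have h1 : 1 < (s : ℝ) * (1 + c) := by
    have hs0 : 0 < s := by
      rw [pos_iff_ne_zero]
      rintro rfl
      simp at hlt
    rw [← ENNReal.coe_inv hs0.ne', ← ENNReal.ofReal_one, ← ENNReal.ofReal_add zero_le_one
      (by linarith), ENNReal.lt_ofReal_iff_toReal_lt ENNReal.coe_ne_top] at hlt
    rw [ENNReal.coe_toReal, NNReal.coe_inv, inv_lt_iff_one_lt_mul₀ (by exact_mod_cast hs0)] at hlt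
    linarith
  rw [hausdorffMeasure_unboundedSet hc h1] at hs
  exact ENNReal.zero_ne_top hs

/-! ### Mixed radix expansions -/

/-- The remainder after `n` digits of the expansion
`y = d₀ / s₀ + d₁ / (s₀ s₁) + d₂ / (s₀ s₁ s₂) + ⋯`, scaled to `[0, 1)`. -/
def mixedRem (s : ℕ → ℕ) (y : ℝ) : ℕ → ℝ
  | 0 => y
  | n + 1 => Int.fract ((s n : ℝ) * mixedRem s y n)

/-- The digit `dₙ` of the expansion `y = d₀ / s₀ + d₁ / (s₀ s₁) + d₂ / (s₀ s₁ s₂) + ⋯`. -/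
def mixedDigit (s : ℕ → ℕ) (y : ℝ) (n : ℕ) : ℕ := ⌊(s n : ℝ) * mixedRem s y n⌋₊

lemma mixedRem_mem_Ico (s : ℕ → ℕ) {y : ℝ} (hy : y ∈ Set.Ico (0 : ℝ) 1) (n : ℕ) :
    mixedRem s y n ∈ Set.Ico (0 : ℝ) 1 := by
  cases n with
  | zero => exact hy
  | succ n => exact ⟨Int.fract_nonneg _, Int.fract_lt_one _⟩

lemma mixedDigit_lt {s : ℕ → ℕ} (hs : ∀ j, 1 ≤ s j) {y : ℝ} (hy : y ∈ Set.Ico (0 : ℝ) 1) (n : ℕ) :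
    mixedDigit s y n < s n := by
  have h := mixedRem_mem_Ico s hy n
  have h1 : (0 : ℝ) < s n := by exact_mod_cast hs n
  rw [mixedDigit, Nat.floor_lt (mul_nonneg h1.le h.1)]
  nlinarith [h.2]

lemma mul_mixedRem {s : ℕ → ℕ} {y : ℝ} (hy : y ∈ Set.Ico (0 : ℝ) 1) (n : ℕ) :
    (s n : ℝ) * mixedRem s y n = mixedDigit s y n + mixedRem s y (n + 1) := by
  have h := mul_nonneg (Nat.cast_nonneg (α := ℝ) (s n)) (mixedRem_mem_Ico s hy n).1
  rw [mixedDigit, mixedRem, natCast_floor_eq_intCast_floor h, Int.floor_add_fract]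

lemma prod_mul_sub_eq {s : ℕ → ℕ} {y z : ℝ}
    (hy : y ∈ Set.Ico (0 : ℝ) 1) (hz : z ∈ Set.Ico (0 : ℝ) 1) (n : ℕ)
    (h : ∀ j < n, mixedDigit s y j = mixedDigit s z j) :
    (∏ j ∈ Finset.range n, (s j : ℝ)) * (y - z) = mixedRem s y n - mixedRem s z n := by
  induction n with
  | zero => simp [mixedRem]
  | succ n ih =>
    have h1 := mul_mixedRem (s := s) hy n
    have h2 := mul_mixedRem (s := s) hz n
    rw [h n (by omega)] at h1
    rw [Finset.prod_range_succ, mul_right_comm, ih fun j hj => h j (by omega)]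
    linarith

lemma prod_mul_abs_sub_le {s : ℕ → ℕ} {y z : ℝ}
    (hy : y ∈ Set.Ico (0 : ℝ) 1) (hz : z ∈ Set.Ico (0 : ℝ) 1) (n : ℕ)
    (h : ∀ j < n, mixedDigit s y j = mixedDigit s z j) :
    (∏ j ∈ Finset.range (n + 1), (s j : ℝ)) * |y - z| ≤
      |(mixedDigit s y n : ℝ) - mixedDigit s z n| + 1 := by
  have hP : (0 : ℝ) ≤ ∏ j ∈ Finset.range (n + 1), (s j : ℝ) := by positivity
  have hy' := mixedRem_mem_Ico s hy (n + 1)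
  have hz' := mixedRem_mem_Ico s hz (n + 1)
  have e : (∏ j ∈ Finset.range (n + 1), (s j : ℝ)) * (y - z) =
      ((mixedDigit s y n : ℝ) - mixedDigit s z n) +
        (mixedRem s y (n + 1) - mixedRem s z (n + 1)) := by
    rw [Finset.prod_range_succ, mul_right_comm, prod_mul_sub_eq hy hz n h]
    linarith [mul_mixedRem (s := s) hy n, mul_mixedRem (s := s) hz n]
  nth_rewrite 1 [← abs_of_nonneg hP]
  rw [← abs_mul, e]
  refine (abs_add_le _ _).trans (add_le_add_right ?_ _)
  exact abs_sub_le_of_nonneg_of_le hy'.1 hy'.2.le hz'.1 hz'.2.le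

lemma exists_mixedDigit_ne {s : ℕ → ℕ}
    (hP : Filter.Tendsto (fun n => ∏ j ∈ Finset.range n, (s j : ℝ)) Filter.atTop Filter.atTop)
    {y z : ℝ} (hy : y ∈ Set.Ico (0 : ℝ) 1) (hz : z ∈ Set.Ico (0 : ℝ) 1) (hyz : y ≠ z) :
    ∃ n, (∀ j < n, mixedDigit s y j = mixedDigit s z j) ∧ mixedDigit s y n ≠ mixedDigit s z n := by
  classical
  by_cases h : ∃ n, mixedDigit s y n ≠ mixedDigit s z n
  · exact ⟨Nat.find h, fun j hj => not_not.1 (Nat.find_min h hj), Nat.find_spec h⟩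
  · push Not at h
    have hpos : 0 < |y - z| := abs_pos.2 (sub_ne_zero.2 hyz)
    obtain ⟨n, hn⟩ := ((hP.comp (Filter.tendsto_add_atTop_nat 1)).eventually_gt_atTop
      (|y - z|⁻¹)).exists
    have h1 := prod_mul_abs_sub_le hy hz n fun j _ => h j
    rw [h n, sub_self, abs_zero, zero_add] at h1
    rw [Function.comp_apply, inv_lt_iff_one_lt_mul₀ hpos] at hn
    linarith

/-! ### The lower bound -/

/-- The irrational numbers with partial quotients `s j < a_{j+1} ≤ 2 * s j`. There are exactly `s j`
choices, and all partial quotients are at least `2` if `1 ≤ s j`, which keeps neighbouring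
cylinders apart. -/
def digitSet (s : ℕ → ℕ) : Set ℝ :=
  {x | x ∈ Set.Icc (0 : ℝ) 1 ∧ Irrational x ∧
    ∀ j, s j < partialQuotient (j + 1) x ∧ partialQuotient (j + 1) x ≤ 2 * s j}

lemma exists_mem_digitSet {s : ℕ → ℕ} (hs : ∀ j, 1 ≤ s j) {y : ℝ} (hy : y ∈ Set.Ico (0 : ℝ) 1) :
    ∃ x ∈ digitSet s, ∀ j, partialQuotient (j + 1) x = s j + 1 + mixedDigit s y j := by
  obtain ⟨x, hx, hirr, hxd⟩ := exists_partialQuotient_eq (fun j => s j + 1 + mixedDigit s y j)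
    fun j => by omega
  refine ⟨x, ⟨hx, hirr, fun j => ?_⟩, hxd⟩
  have := mixedDigit_lt hs hy j
  rw [hxd]
  omega

lemma one_le_abs_natCast_sub {m n : ℕ} (h : m ≠ n) : (1 : ℝ) ≤ |(m : ℝ) - n| := by
  rw [← Int.cast_natCast m, ← Int.cast_natCast n, ← Int.cast_sub, ← Int.cast_abs, ← Int.cast_one,
    Int.cast_le]
  exact Int.one_le_abs (sub_ne_zero.2 (Nat.cast_injective.ne h))

lemma le_abs_sub_of_mem_digitSet {s : ℕ → ℕ} (hs : ∀ j, 1 ≤ s j) {x y : ℝ} (hx : x ∈ digitSet s)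
    (hy : y ∈ digitSet s) (n : ℕ)
    (h : ∀ j < n, partialQuotient (j + 1) x = partialQuotient (j + 1) y)
    (hn : partialQuotient (n + 1) x ≠ partialQuotient (n + 1) y) :
    |(partialQuotient (n + 1) x : ℝ) - partialQuotient (n + 1) y| /
      (2 * (9 ^ (n + 1) * (∏ j ∈ Finset.range (n + 1), (s j : ℝ)) ^ 2)) ≤ |x - y| := by
  have hs' : ∀ j, (1 : ℝ) ≤ s j := fun j => by exact_mod_cast hs j
  have orbit : ∀ z ∈ digitSet s, ∀ j, ((3 * s j : ℝ))⁻¹ ≤ gaussMap^[j] z ∧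
      gaussMap^[j] z ∈ Set.Icc (0 : ℝ) (1 / 2) := by
    intro z hz j
    have h1 := hz.2.2 j
    have h2 : (2 : ℝ) ≤ partialQuotient (j + 1) z := by exact_mod_cast (by have := hs j; omega)
    have h3 : (partialQuotient (j + 1) z : ℝ) ≤ 2 * s j := by exact_mod_cast h1.2
    refine ⟨(inv_anti₀ (by positivity) (by linarith [hs' j])).trans
      (le_iterate_gaussMap hz.2.1 hz.1 j), (iterate_gaussMap_mem_Ioo hz.2.1 hz.1 j).1.le, ?_⟩
    refine (iterate_gaussMap_le hz.2.1 hz.1 j).trans ?_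
    rw [one_div]
    exact inv_anti₀ two_pos h2
  set D := |(partialQuotient (n + 1) x : ℝ) - partialQuotient (n + 1) y|
  have hD : 1 ≤ D := one_le_abs_natCast_sub hn
  -- The fractional parts of the inverted points lie in `[0, 1/2]`, so they cancel at most half.
  have hstep : D / 2 * ((3 * s n : ℝ)⁻¹ * (3 * s n : ℝ)⁻¹) ≤
      |gaussMap^[n] x - gaussMap^[n] y| := by
    rw [abs_iterate_sub hx.2.1 hx.1 hy.2.1 hy.1 n]
    have hpos : (0 : ℝ) < (3 * s n : ℝ)⁻¹ := inv_pos.2 (by linarith [hs' n])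
    refine mul_le_mul ?_ (mul_le_mul (orbit x hx n).1 (orbit y hy n).1 hpos.le
      (orbit x hx n).2.1) (by positivity) (abs_nonneg _)
    have h1 := abs_sub_le_of_nonneg_of_le (orbit x hx (n + 1)).2.1 (orbit x hx (n + 1)).2.2
      (orbit y hy (n + 1)).2.1 (orbit y hy (n + 1)).2.2
    rw [add_sub_add_comm]
    have h2 := abs_sub_abs_le_abs_sub
      ((partialQuotient (n + 1) x : ℝ) - partialQuotient (n + 1) y)
      (-(gaussMap^[n + 1] x - gaussMap^[n + 1] y))
    rw [sub_neg_eq_add, abs_neg] at h2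
    change D - _ ≤ _ at h2
    linarith
  have hprod : ∏ j ∈ Finset.range n, ((3 * s j : ℝ)⁻¹ * (3 * s j : ℝ)⁻¹) ≤
      ∏ j ∈ Finset.range n, (((partialQuotient (j + 1) x : ℝ) + 1) ^ 2)⁻¹ := by
    refine Finset.prod_le_prod (fun j _ => by positivity) fun j _ => ?_
    have h3 : (partialQuotient (j + 1) x : ℝ) ≤ 2 * s j := by exact_mod_cast (hx.2.2 j).2
    rw [← mul_inv, ← pow_two]
    exact inv_anti₀ (by positivity) (pow_le_pow_left₀ (by positivity) (by linarith [hs' j]) 2)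
  refine le_trans (le_of_eq ?_) ((mul_le_mul hstep hprod
    (Finset.prod_nonneg fun j _ => by positivity) (abs_nonneg _)).trans
      (le_abs_sub_of_partialQuotient_eq hx.2.1 hx.1 hy.2.1 hy.1 n h))
  have e : ∏ j ∈ Finset.range n, ((3 * s j : ℝ)⁻¹ * (3 * s j : ℝ)⁻¹) =
      (9 ^ n * (∏ j ∈ Finset.range n, (s j : ℝ)) ^ 2)⁻¹ := by
    have h1 : ∀ j, (3 * s j : ℝ)⁻¹ * (3 * s j : ℝ)⁻¹ = 9⁻¹ * ((s j : ℝ) ^ 2)⁻¹ := fun j => by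
      rw [← mul_inv, ← mul_inv]
      ring
    simp_rw [h1, Finset.prod_mul_distrib, Finset.prod_const, Finset.card_range,
      Finset.prod_inv_distrib, Finset.prod_pow, mul_inv, inv_pow]
  have h0 : (s n : ℝ) ≠ 0 := by linarith [hs' n]
  have hP0 : (∏ j ∈ Finset.range n, (s j : ℝ)) ≠ 0 :=
    Finset.prod_ne_zero_iff.2 fun j _ => by linarith [hs' j]
  rw [e, Finset.prod_range_succ]
  field_simp
  ring

/-- The numbers of `digitSet s` are encoded by their mixed radix expansion. Decoding is Hölder
continuous of exponent `t`, and it maps onto `[0, 1)`. -/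
lemma le_dimH_digitSet {s : ℕ → ℕ} (hs : ∀ j, 1 ≤ s j)
    (hP : Filter.Tendsto (fun n => ∏ j ∈ Finset.range n, (s j : ℝ)) Filter.atTop Filter.atTop)
    {t : NNReal} (ht : 0 < t) (ht1 : t ≤ 1) {K : ℝ}
    (hK : ∀ n : ℕ, t * Real.log (∏ j ∈ Finset.range (n + 1), (s j : ℝ)) -
      (1 - t) * Real.log (∏ j ∈ Finset.range n, (s j : ℝ)) + 8 * (n + 1) ≤ K) :
    (t : ENNReal) ≤ dimH (digitSet s) := by
  have hs' : ∀ j, (1 : ℝ) ≤ s j := fun j => by exact_mod_cast hs j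
  have ht' : (0 : ℝ) < t := by exact_mod_cast ht
  have ht1' : (t : ℝ) ≤ 1 := by exact_mod_cast ht1
  choose! x hxE hxd using fun (y : ℝ) (hy : y ∈ Set.Ico (0 : ℝ) 1) => exists_mem_digitSet hs hy
  have hmain : ∀ y ∈ Set.Ico (0 : ℝ) 1, ∀ z ∈ Set.Ico (0 : ℝ) 1,
      |y - z| ≤ Real.exp (K + 2) * |x y - x z| ^ (t : ℝ) := by
    intro y hy z hz
    rcases eq_or_ne y z with rfl | hyz
    · simp [ht'.ne']
    obtain ⟨n, hn, hn'⟩ := exists_mixedDigit_ne hP hy hz hyz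
    have h1 := le_abs_sub_of_mem_digitSet hs (hxE y hy) (hxE z hz) n
      (fun j hj => by rw [hxd y hy, hxd z hz, hn j hj])
      (fun h => hn' (by rw [hxd y hy, hxd z hz] at h; omega))
    have h2 := prod_mul_abs_sub_le hy hz n hn
    rw [hxd y hy, hxd z hz] at h1
    push_cast at h1
    rw [add_sub_add_left_eq_sub] at h1
    set D := |(mixedDigit s y n : ℝ) - mixedDigit s z n|
    have hD : 1 ≤ D := one_le_abs_natCast_sub hn'
    have hDs : D ≤ s n := by
      have h3 : (mixedDigit s y n : ℝ) ≤ s n := by exact_mod_cast (mixedDigit_lt hs hy n).le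
      have h4 : (mixedDigit s z n : ℝ) ≤ s n := by exact_mod_cast (mixedDigit_lt hs hz n).le
      exact abs_sub_le_of_nonneg_of_le (by positivity) h3 (by positivity) h4
    set P := ∏ j ∈ Finset.range (n + 1), (s j : ℝ) with hPdef
    have hPn : (0 : ℝ) < ∏ j ∈ Finset.range n, (s j : ℝ) :=
      Finset.prod_pos fun j _ => by linarith [hs' j]
    have hPpos : 0 < P := Finset.prod_pos fun j _ => by linarith [hs' j]
    have hsn : (0 : ℝ) < s n := by linarith [hs' n]
    have hlogP : Real.log P = Real.log (∏ j ∈ Finset.range n, (s j : ℝ)) + Real.log (s n) := by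
      rw [hPdef, Finset.prod_range_succ, Real.log_mul hPn.ne' hsn.ne']
    have h3 : |y - z| ≤ 2 * D / P := by
      rw [le_div_iff₀ hPpos]
      linarith
    refine h3.trans (le_trans ?_ (mul_le_mul_of_nonneg_left (Real.rpow_le_rpow
      (by positivity) h1 ht'.le) (Real.exp_pos _).le))
    rw [← Real.log_le_log_iff (by positivity) (by positivity),
      Real.log_mul (Real.exp_pos _).ne' (by positivity), Real.log_exp,
      Real.log_rpow (by positivity), Real.log_div (by positivity) hPpos.ne',
      Real.log_mul two_ne_zero (by positivity), Real.log_div (by positivity) (by positivity),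
      Real.log_mul two_ne_zero (by positivity), Real.log_mul (by positivity) (by positivity),
      Real.log_pow, Real.log_pow]
    have hl2 : Real.log 2 ≤ 1 := by linarith [Real.log_le_sub_one_of_pos (x := 2) two_pos]
    have hl20 : 0 ≤ Real.log 2 := Real.log_nonneg one_le_two
    have hl9 : Real.log 9 ≤ 8 := by
      linarith [Real.log_le_sub_one_of_pos (x := 9) (by norm_num)]
    have hl90 : 0 ≤ Real.log 9 := Real.log_nonneg (by norm_num)
    have hlD : Real.log D ≤ Real.log (s n) := Real.log_le_log (by linarith) hDs
    have hKn := hK n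
    rw [← hPdef] at hKn
    have e1 : (1 - (t : ℝ)) * Real.log D ≤ (1 - t) * Real.log (s n) :=
      mul_le_mul_of_nonneg_left hlD (by linarith)
    have e2 : (t : ℝ) * ((n + 1) * Real.log 9) ≤ 8 * (n + 1) := by
      have : ((n : ℝ) + 1) * Real.log 9 ≤ (n + 1) * 8 :=
        mul_le_mul_of_nonneg_left hl9 (by positivity)
      have h0 : 0 ≤ ((n : ℝ) + 1) * Real.log 9 := by positivity
      nlinarith
    have e3 : (t : ℝ) * Real.log 2 ≤ 1 := by nlinarith
    push_cast
    rw [hlogP] at hKn ⊢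
    nlinarith
  have hinj : Set.InjOn x (Set.Ico 0 1) := by
    intro y hy z hz h
    have h1 := hmain y hy z hz
    rw [h, sub_self, abs_zero, Real.zero_rpow ht'.ne', mul_zero] at h1
    exact sub_eq_zero.1 (abs_eq_zero.1 (le_antisymm h1 (abs_nonneg _)))
  have hleft := hinj.leftInvOn_invFunOn
  set f := Function.invFunOn x (Set.Ico 0 1)
  have hf : HolderOnWith (Real.toNNReal (Real.exp (K + 2))) t f (x '' Set.Ico 0 1) := by
    rintro _ ⟨y, hy, rfl⟩ _ ⟨z, hz, rfl⟩
    rw [hleft hy, hleft hz, edist_dist, edist_dist, Real.dist_eq, Real.dist_eq,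
      ENNReal.ofReal_rpow_of_nonneg (abs_nonneg _) ht'.le, ← ENNReal.ofReal,
      ← ENNReal.ofReal_mul (Real.exp_pos _).le]
    exact ENNReal.ofReal_le_ofReal (hmain y hy z hz)
  have h1 := hf.dimH_image_le ht
  rw [hleft.image_image, Real.dimH_of_nonempty_interior (by simp), Module.finrank_self,
    Nat.cast_one, ENNReal.le_div_iff_mul_le (by simp [ht.ne']) (by simp), one_mul] at h1
  refine h1.trans (dimH_mono ?_)
  rintro _ ⟨y, hy, rfl⟩
  exact hxE y hy

/-! ### Prescribed growth of the sum of logarithms -/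

/-- The digit bounds for which `logSum n` follows the nondecreasing function `L`. -/
def digitBound (L : ℕ → ℝ) (j : ℕ) : ℕ := ⌊Real.exp (L (j + 1) - L j)⌋₊

lemma one_le_digitBound {L : ℕ → ℝ} (hL : Monotone L) (j : ℕ) : 1 ≤ digitBound L j := by
  rw [digitBound, Nat.one_le_floor_iff]
  exact Real.one_le_exp (sub_nonneg.2 (hL j.le_succ))

lemma log_digitBound_mem_Icc {L : ℕ → ℝ} (hL : Monotone L) (j : ℕ) :
    Real.log (digitBound L j) ∈ Set.Icc (L (j + 1) - L j - 1) (L (j + 1) - L j) := by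
  have h1 : (1 : ℝ) ≤ digitBound L j := by exact_mod_cast one_le_digitBound hL j
  have hl2 : Real.log 2 ≤ 1 := by linarith [Real.log_le_sub_one_of_pos (x := 2) two_pos]
  constructor
  · have h2 : Real.exp (L (j + 1) - L j) ≤ 2 * digitBound L j := by
      have := (Nat.lt_floor_add_one (Real.exp (L (j + 1) - L j))).le
      change _ ≤ (digitBound L j : ℝ) + 1 at this
      linarith
    have h3 := Real.log_le_log (Real.exp_pos _) h2
    rw [Real.log_exp, Real.log_mul two_ne_zero (by positivity)] at h3
    linarith
  · have h2 : (digitBound L j : ℝ) ≤ Real.exp (L (j + 1) - L j) := Nat.floor_le (Real.exp_pos _).le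
    have h3 := Real.log_le_log (by linarith) h2
    rwa [Real.log_exp] at h3

lemma log_prod_digitBound_mem_Icc {L : ℕ → ℝ} (hL : Monotone L) (n : ℕ) :
    Real.log (∏ j ∈ Finset.range n, (digitBound L j : ℝ)) ∈
      Set.Icc (L n - L 0 - n) (L n - L 0) := by
  have h0 : ∀ j, (digitBound L j : ℝ) ≠ 0 := fun j => by
    exact_mod_cast Nat.one_le_iff_ne_zero.1 (one_le_digitBound hL j)
  induction n with
  | zero => simp
  | succ n ih =>
    rw [Finset.prod_range_succ, Real.log_mul (Finset.prod_ne_zero_iff.2 fun j _ => h0 j) (h0 n)]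
    have h1 := log_digitBound_mem_Icc hL n
    push_cast
    exact ⟨by linarith [h1.1, ih.1], by linarith [h1.2, ih.2]⟩

lemma abs_logSum_sub_le {L : ℕ → ℝ} (hL : Monotone L) {x : ℝ} (hx : x ∈ digitSet (digitBound L))
    (n : ℕ) : |logSum n x - L n| ≤ n + |L 0| := by
  have key : logSum n x - (L n - L 0) ∈ Set.Icc (-(n : ℝ)) n := by
    induction n with
    | zero => simp
    | succ n ih =>
      have h1 := log_digitBound_mem_Icc hL n
      have h2 : (1 : ℝ) ≤ digitBound L n := by exact_mod_cast one_le_digitBound hL n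
      have h3 : (digitBound L n : ℝ) ≤ partialQuotient (n + 1) x := by
        exact_mod_cast (hx.2.2 n).1.le
      have h4 : (partialQuotient (n + 1) x : ℝ) ≤ 2 * digitBound L n := by
        exact_mod_cast (hx.2.2 n).2
      have h5 := Real.log_le_log (by linarith) h3
      have h6 := Real.log_le_log (by linarith) h4
      rw [Real.log_mul two_ne_zero (by positivity)] at h6
      have hl2 : Real.log 2 ≤ 1 := by linarith [Real.log_le_sub_one_of_pos (x := 2) two_pos]
      rw [logSum_succ]
      push_cast
      exact ⟨by linarith [h1.1, ih.1], by linarith [h1.2, ih.2]⟩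
  rw [abs_le]
  exact ⟨by linarith [key.1, neg_abs_le (L 0), le_abs_self (L 0)],
    by linarith [key.2, neg_abs_le (L 0), le_abs_self (L 0)]⟩

lemma digitSet_digitBound_nonempty {L : ℕ → ℝ} (hL : Monotone L) :
    (digitSet (digitBound L)).Nonempty := by
  obtain ⟨x, hx, -⟩ := exists_mem_digitSet (one_le_digitBound hL) (y := 0) (by simp)
  exact ⟨x, hx⟩

lemma le_dimH_digitSet_digitBound {L : ℕ → ℝ} (hL : Monotone L)
    (hgrow : ∀ M : ℝ, ∀ᶠ n : ℕ in Filter.atTop, M * n ≤ L n) {c : ℝ} (hc : 0 < c)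
    (hratio : ∀ n, L (n + 1) ≤ c * L n) :
    (1 + ENNReal.ofReal c)⁻¹ ≤ dimH (digitSet (digitBound L)) := by
  have hlog := log_prod_digitBound_mem_Icc hL
  have hPpos : ∀ n, 0 < ∏ j ∈ Finset.range n, (digitBound L j : ℝ) := fun n =>
    Finset.prod_pos fun j _ => by exact_mod_cast one_le_digitBound hL j
  have hP : Filter.Tendsto (fun n => ∏ j ∈ Finset.range n, (digitBound L j : ℝ))
      Filter.atTop Filter.atTop := by
    have h1 : Filter.Tendsto (fun n => Real.log (∏ j ∈ Finset.range n, (digitBound L j : ℝ)))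
        Filter.atTop Filter.atTop := by
      refine Filter.tendsto_atTop_mono' _ ?_
        (Filter.tendsto_atTop_add_const_right _ (-L 0) tendsto_natCast_atTop_atTop)
      filter_upwards [hgrow 2] with n hn
      linarith [(hlog n).1]
    refine (Real.tendsto_exp_atTop.comp h1).congr fun n => ?_
    rw [Function.comp_apply, Real.exp_log (hPpos n)]
  refine le_of_forall_lt fun r hr => ?_
  obtain ⟨t, hrt, htc⟩ := ENNReal.lt_iff_exists_nnreal_btwn.1 hr
  refine hrt.trans_le ?_
  have ht0 : 0 < t := by
    rw [← ENNReal.coe_pos]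
    exact (zero_le).trans_lt hrt
  have ht : (t : ℝ) * (1 + c) < 1 := by
    rw [ENNReal.lt_inv_iff_lt_inv, ← ENNReal.coe_inv ht0.ne', ← ENNReal.ofReal_one,
      ← ENNReal.ofReal_add zero_le_one hc.le, ENNReal.ofReal_lt_iff_lt_toReal (by linarith)
      ENNReal.coe_ne_top, ENNReal.coe_toReal, NNReal.coe_inv, ← one_div,
      lt_div_iff₀ (by exact_mod_cast ht0)] at htc
    linarith
  have ht0' : (0 : ℝ) < t := by exact_mod_cast ht0
  have ht1 : (t : ℝ) ≤ 1 := by nlinarith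
  have hη : 0 < 1 - (t : ℝ) - t * c := by linarith
  obtain ⟨K, hK⟩ : BddAbove (Set.range fun n : ℕ =>
      t * Real.log (∏ j ∈ Finset.range (n + 1), (digitBound L j : ℝ)) -
      (1 - t) * Real.log (∏ j ∈ Finset.range n, (digitBound L j : ℝ)) + 8 * (n + 1)) := by
    refine Filter.IsBoundedUnder.bddAbove_range ⟨2 * |L 0| + 8, ?_⟩
    rw [Filter.eventually_map]
    filter_upwards [hgrow (9 / (1 - t - t * c))] with n hn
    rw [div_mul_eq_mul_div, div_le_iff₀ hη] at hn
    have h1 : (t : ℝ) * Real.log (∏ j ∈ Finset.range (n + 1), (digitBound L j : ℝ)) ≤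
        t * (c * L n - L 0) :=
      mul_le_mul_of_nonneg_left (by linarith [(hlog (n + 1)).2, hratio n]) ht0'.le
    have h2 : (1 - (t : ℝ)) * (L n - L 0 - n) ≤
        (1 - t) * Real.log (∏ j ∈ Finset.range n, (digitBound L j : ℝ)) :=
      mul_le_mul_of_nonneg_left (hlog n).1 (by linarith)
    have h3 : (1 - (t : ℝ)) * n ≤ n := by
      nlinarith [mul_nonneg ht0'.le (Nat.cast_nonneg (α := ℝ) n)]
    have h4 : (1 - 2 * (t : ℝ)) * L 0 ≤ 1 * |L 0| := by
      refine (le_abs_self _).trans ?_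
      rw [abs_mul]
      exact mul_le_mul_of_nonneg_right (abs_le.2 ⟨by linarith, by linarith⟩) (abs_nonneg _)
    nlinarith [abs_nonneg (L 0)]
  exact le_dimH_digitSet (one_le_digitBound hL) hP ht0 (by exact_mod_cast ht1)
    fun n => hK ⟨n, rfl⟩

/-! ### Envelopes of a function of superlinear growth -/

lemma tendsto_atTop_of_superlinear {φ : ℕ → ℝ}
    (hφ : ∀ M : ℝ, ∀ᶠ n : ℕ in Filter.atTop, M * n ≤ φ n) :
    Filter.Tendsto φ Filter.atTop Filter.atTop :=
  Filter.tendsto_atTop_mono' _ ((hφ 1).mono fun n hn => by simpa using hn)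
    tendsto_natCast_atTop_atTop

lemma exists_isMin_from {φ : ℕ → ℝ} (hφ : Filter.Tendsto φ Filter.atTop Filter.atTop) (N : ℕ) :
    ∃ n, N ≤ n ∧ ∀ k, N ≤ k → φ n ≤ φ k := by
  have h : Filter.Tendsto (fun k => φ (k + N)) Filter.cofinite Filter.atTop := by
    rw [Nat.cofinite_eq_atTop]
    exact hφ.comp (Filter.tendsto_add_atTop_nat N)
  obtain ⟨n, hn⟩ := h.exists_forall_le
  refine ⟨n + N, by omega, fun k hk => ?_⟩
  obtain ⟨m, rfl⟩ := Nat.exists_eq_add_of_le' hk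
  exact hn m

/-- The largest nondecreasing minorant. -/
lemma exists_monotone_minorant {φ : ℕ → ℝ} (hφ0 : ∀ k, 1 ≤ φ k)
    (hφ : ∀ M : ℝ, ∀ᶠ n : ℕ in Filter.atTop, M * n ≤ φ n) :
    ∃ L : ℕ → ℝ, Monotone L ∧ (∀ M : ℝ, ∀ᶠ n : ℕ in Filter.atTop, M * n ≤ L n) ∧
      (∀ n, L n ≤ φ n) ∧ ∃ᶠ n in Filter.atTop, L n = φ n := by
  have hbdd : ∀ n, BddBelow (Set.range fun k => φ (n + k)) := fun n =>
    ⟨1, by rintro _ ⟨k, rfl⟩; exact hφ0 _⟩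
  refine ⟨fun n => ⨅ k, φ (n + k), monotone_nat_of_le_succ fun n => ?_, fun M => ?_, fun n => ?_, ?_⟩
  · refine le_ciInf fun k => (ciInf_le (hbdd n) (k + 1)).trans (le_of_eq ?_)
    congr 1
    omega
  · obtain ⟨N, hN⟩ := Filter.eventually_atTop.1 (hφ |M|)
    filter_upwards [Filter.eventually_ge_atTop N] with n hn
    refine le_ciInf fun k => le_trans ?_ (hN (n + k) (by omega))
    exact mul_le_mul (le_abs_self M) (by push_cast; linarith [Nat.cast_nonneg (α := ℝ) k])
      (by positivity) (abs_nonneg _)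
  · exact ciInf_le (hbdd n) 0
  · rw [Filter.frequently_atTop]
    intro N
    obtain ⟨n, hn, hmin⟩ := exists_isMin_from (tendsto_atTop_of_superlinear hφ) N
    exact ⟨n, hn, le_antisymm (ciInf_le (hbdd n) 0) (le_ciInf fun k => hmin _ (by omega))⟩

/-- The largest nondecreasing minorant that grows at most by the factor `c` in each step. It is the
infimum of the functions equal to `φ k` up to `k` and growing by the factor `c` after `k`. -/
lemma exists_slow_minorant {φ : ℕ → ℝ} (hφ0 : ∀ k, 1 ≤ φ k)
    (hφ : ∀ M : ℝ, ∀ᶠ n : ℕ in Filter.atTop, M * n ≤ φ n) {c : ℝ} (hc : 1 < c)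
    (hlow : ∀ ε > 0, ∃ n, φ n < ε * c ^ n) :
    ∃ L : ℕ → ℝ, Monotone L ∧ (∀ M : ℝ, ∀ᶠ n : ℕ in Filter.atTop, M * n ≤ L n) ∧
      (∀ n, L n ≤ φ n) ∧ (∃ᶠ n in Filter.atTop, L n = φ n) ∧ ∀ n, L (n + 1) ≤ c * L n := by
  have hc0 : 0 < c := by linarith
  have hφpos : ∀ k, 0 < φ k := fun k => by linarith [hφ0 k]
  -- Truncated subtraction makes `w k n = φ k` for `n ≤ k`.
  let w : ℕ → ℕ → ℝ := fun n k => φ k * c ^ (n - k)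
  have hw : ∀ n k, φ k ≤ w n k := fun n k =>
    le_mul_of_one_le_right (hφpos k).le (one_le_pow₀ hc.le)
  have hbdd : ∀ n, BddBelow (Set.range (w n)) := fun n =>
    ⟨1, by rintro _ ⟨k, rfl⟩; exact (hφ0 k).trans (hw n k)⟩
  have hle : ∀ n, ⨅ k, w n k ≤ φ n := fun n =>
    (ciInf_le (hbdd n) n).trans (le_of_eq (by simp [w]))
  refine ⟨fun n => ⨅ k, w n k, monotone_nat_of_le_succ fun n => ?_, fun M => ?_, hle, ?_,
    fun n => ?_⟩
  · exact ciInf_mono (hbdd n) fun k =>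
      mul_le_mul_of_nonneg_left (pow_le_pow_right₀ hc.le (by omega)) (hφpos k).le
  · obtain ⟨N, hN⟩ := Filter.eventually_atTop.1
      ((hφ |M|).and (tendsto_natCast_atTop_atTop.eventually_ge_atTop (1 / (c - 1))))
    have hexp : ∀ᶠ n : ℕ in Filter.atTop, |M| * n ≤ c ^ (n - N) := by
      have hlim : Filter.Tendsto (fun n : ℕ => (n : ℝ) / c ^ n) Filter.atTop (nhds 0) := by
        simpa using tendsto_pow_const_div_const_pow_of_one_lt 1 hc
      filter_upwards [hlim.eventually_lt_const (show 0 < 1 / ((|M| + 1) * c ^ N) by positivity),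
        Filter.eventually_ge_atTop N] with n hn hnN
      rw [div_lt_div_iff₀ (by positivity) (by positivity), one_mul,
        ← Nat.sub_add_cancel hnN, pow_add, Nat.sub_add_cancel hnN, ← mul_assoc] at hn
      have := lt_of_mul_lt_mul_right hn (by positivity)
      nlinarith [Nat.cast_nonneg (α := ℝ) n]
    filter_upwards [hexp, Filter.eventually_ge_atTop N] with n hn hnN
    refine (mul_le_mul_of_nonneg_right (le_abs_self M) (Nat.cast_nonneg n)).trans
      (le_ciInf fun k => ?_)
    rcases lt_or_ge k N with hk | hk
    · refine hn.trans ((pow_le_pow_right₀ hc.le (by omega : n - N ≤ n - k)).trans ?_)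
      exact le_mul_of_one_le_left (by positivity) (hφ0 k)
    rcases le_or_gt n k with hnk | hnk
    · refine le_trans ?_ ((hN k hk).1.trans (hw n k))
      exact mul_le_mul_of_nonneg_left (by exact_mod_cast hnk) (abs_nonneg _)
    -- Bernoulli's inequality: `k * c ^ m ≥ k + m` as soon as `k * (c - 1) ≥ 1`.
    · obtain ⟨m, rfl⟩ := Nat.exists_eq_add_of_lt hnk
      have h1 := (hN k hk).1
      have h2 := (hN k hk).2
      rw [div_le_iff₀ (by linarith)] at h2
      have h3 := one_add_mul_sub_le_pow (show -1 ≤ c by linarith) (m + 1)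
      have e : k + m + 1 - k = m + 1 := by omega
      simp only [w, e]
      have h4 : ((k + m + 1 : ℕ) : ℝ) ≤ k * c ^ (m + 1) := by
        push_cast at h3 ⊢
        have hk0 : (0 : ℝ) ≤ k := by positivity
        have hm0 : (0 : ℝ) ≤ (m : ℝ) + 1 := by positivity
        nlinarith [mul_le_mul_of_nonneg_left h3 hk0, mul_le_mul_of_nonneg_left h2 hm0]
      calc |M| * ((k + m + 1 : ℕ) : ℝ) ≤ |M| * (k * c ^ (m + 1)) :=
            mul_le_mul_of_nonneg_left h4 (abs_nonneg _)
        _ = |M| * k * c ^ (m + 1) := by ring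
        _ ≤ φ k * c ^ (m + 1) := mul_le_mul_of_nonneg_right h1 (by positivity)
  · rw [Filter.frequently_atTop]
    intro N
    obtain ⟨ε, hε, hεN⟩ : ∃ ε > 0, ∀ j ≤ N, ε * c ^ j ≤ φ j :=
      ⟨(c ^ N)⁻¹, by positivity, fun j hj => by
        refine le_trans ?_ (hφ0 j)
        rw [inv_mul_le_iff₀ (by positivity), mul_one]
        exact pow_le_pow_right₀ hc.le hj⟩
    classical
    -- The first `m` with `φ m < ε * c ^ m`, followed by a minimum of `φ` on `[m, ∞)`.
    have hm := Nat.find_spec (hlow ε hε)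
    have hmin : ∀ j < Nat.find (hlow ε hε), ε * c ^ j ≤ φ j := fun j hj =>
      not_lt.1 (Nat.find_min (hlow ε hε) hj)
    set m := Nat.find (hlow ε hε)
    have hNm : N < m := by
      by_contra h
      linarith [hεN m (not_lt.1 h)]
    obtain ⟨n, hn, hnmin⟩ := exists_isMin_from (tendsto_atTop_of_superlinear hφ) m
    refine ⟨n, by omega, le_antisymm (hle n) (le_ciInf fun k => ?_)⟩
    rcases le_or_gt m k with hk | hk
    · exact (hnmin k hk).trans (hw n k)
    · calc φ n ≤ φ m := hnmin m le_rfl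
        _ ≤ ε * c ^ m := hm.le
        _ = ε * c ^ k * c ^ (m - k) := by rw [mul_assoc, ← pow_add]; congr 2; omega
        _ ≤ φ k * c ^ (n - k) := mul_le_mul (hmin k hk) (pow_le_pow_right₀ hc.le (by omega))
            (by positivity) (hφpos k).le
  · rw [Real.mul_iInf_of_nonneg hc0.le]
    refine ciInf_mono (hbdd (n + 1)) fun k => ?_
    have h1 : c ^ (n + 1 - k) ≤ c * c ^ (n - k) := by
      rw [← pow_succ']
      exact pow_le_pow_right₀ hc.le (by omega)
    calc φ k * c ^ (n + 1 - k) ≤ φ k * (c * c ^ (n - k)) :=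
          mul_le_mul_of_nonneg_left h1 (hφpos k).le
      _ = c * (φ k * c ^ (n - k)) := by ring

/-- The smallest nondecreasing majorant. -/
lemma exists_monotone_majorant {φ : ℕ → ℝ} (hφ : Filter.Tendsto φ Filter.atTop Filter.atTop) :
    ∃ L : ℕ → ℝ, Monotone L ∧ (∀ n, φ n ≤ L n) ∧ ∃ᶠ n in Filter.atTop, L n = φ n := by
  refine ⟨partialSups φ, (partialSups φ).monotone, le_partialSups φ, ?_⟩
  refine (Filter.frequently_high_scores hφ).mono fun n hn => le_antisymm ?_ (le_partialSups φ n)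
  refine partialSups_le φ n _ fun k hk => ?_
  rcases hk.lt_or_eq with h | rfl
  exacts [(hn k h).le, le_rfl]

/-- The smallest nondecreasing majorant that grows at most by the factor `c` in each step. It is the
supremum of the functions equal to `φ k` after `k` and growing by the factor `c` up to `k`. -/
lemma exists_slow_majorant {φ : ℕ → ℝ} (hφ0 : ∀ k, 1 ≤ φ k)
    (hφ : Filter.Tendsto φ Filter.atTop Filter.atTop) {c : ℝ} (hc : 1 < c)
    (hup : Filter.Tendsto (fun n => c ^ n / φ n) Filter.atTop Filter.atTop) :
    ∃ L : ℕ → ℝ, Monotone L ∧ (∀ n, φ n ≤ L n) ∧ (∃ᶠ n in Filter.atTop, L n = φ n) ∧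
      ∀ n, L (n + 1) ≤ c * L n := by
  have hc0 : 0 < c := by linarith
  have hφpos : ∀ k, 0 < φ k := fun k => by linarith [hφ0 k]
  -- Truncated subtraction makes `w k n = φ k` for `k ≤ n`.
  let w : ℕ → ℕ → ℝ := fun n k => φ k / c ^ (k - n)
  obtain ⟨A, hA⟩ : ∃ A, ∀ k, φ k ≤ A * c ^ k := by
    obtain ⟨n, -, hn⟩ := exists_isMin_from hup 0
    refine ⟨φ n / c ^ n, fun k => ?_⟩
    have h1 := hn k k.zero_le
    rw [div_le_div_iff₀ (hφpos n) (hφpos k)] at h1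
    rw [div_mul_eq_mul_div, le_div_iff₀ (by positivity)]
    linarith
  have hA0 : 0 ≤ A := by have h := hA 0; rw [pow_zero, mul_one] at h; linarith [hφ0 0]
  have hbdd : ∀ n, BddAbove (Set.range (w n)) := fun n => by
    refine ⟨A * c ^ n, ?_⟩
    rintro _ ⟨k, rfl⟩
    change φ k / c ^ (k - n) ≤ _
    rw [div_le_iff₀ (by positivity), mul_assoc, ← pow_add]
    exact (hA k).trans (mul_le_mul_of_nonneg_left (pow_le_pow_right₀ hc.le (by omega)) hA0)
  have hle : ∀ n, φ n ≤ ⨆ k, w n k := fun n =>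
    (le_of_eq (by simp [w])).trans (le_ciSup (hbdd n) n)
  refine ⟨fun n => ⨆ k, w n k, monotone_nat_of_le_succ fun n => ?_, hle, ?_, fun n => ?_⟩
  · exact ciSup_mono (hbdd (n + 1)) fun k => div_le_div_of_nonneg_left (hφpos k).le (by positivity)
      (pow_le_pow_right₀ hc.le (by omega))
  · rw [Filter.frequently_atTop]
    intro N
    -- A record `m` of `φ`, followed by a maximum of `φ k / c ^ k` on `[m, ∞)`.
    obtain ⟨m, hNm, hm⟩ := Filter.frequently_atTop.1 (Filter.frequently_high_scores hφ) N
    obtain ⟨n, hn, hnmin⟩ := exists_isMin_from hup m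
    have hcmp : ∀ k, m ≤ k → φ k * c ^ n ≤ φ n * c ^ k := fun k hk => by
      have h1 := hnmin k hk
      rw [div_le_div_iff₀ (hφpos n) (hφpos k)] at h1
      linarith
    have hbelow : ∀ k, m ≤ k → k ≤ n → φ k ≤ φ n := fun k hk hkn => by
      refine le_of_mul_le_mul_right ((hcmp k hk).trans ?_) (show 0 < c ^ n by positivity)
      exact mul_le_mul_of_nonneg_left (pow_le_pow_right₀ hc.le hkn) (hφpos n).le
    refine ⟨n, by omega, le_antisymm (ciSup_le fun k => ?_) (hle n)⟩
    change φ k / c ^ (k - n) ≤ φ n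
    rw [div_le_iff₀ (by positivity)]
    rcases le_or_gt k n with hk | hk
    · rw [Nat.sub_eq_zero_of_le hk, pow_zero, mul_one]
      rcases lt_or_ge k m with hkm | hkm
      · exact (hm k hkm).le.trans (hbelow m le_rfl hn)
      · exact hbelow k hkm hk
    · refine le_of_mul_le_mul_right ((hcmp k (by omega)).trans (le_of_eq ?_))
        (show 0 < c ^ n by positivity)
      rw [mul_assoc, ← pow_add]
      congr 2
      omega
  · refine ciSup_le fun k => le_trans ?_ (mul_le_mul_of_nonneg_left (le_ciSup (hbdd n) k) hc0.le)
    change φ k / c ^ (k - (n + 1)) ≤ c * (φ k / c ^ (k - n))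
    rw [mul_div_assoc', div_le_div_iff₀ (by positivity) (by positivity)]
    have h1 : c ^ (k - n) ≤ c * c ^ (k - (n + 1)) := by
      rw [← pow_succ']
      exact pow_le_pow_right₀ hc.le (by omega)
    calc φ k * c ^ (k - n) ≤ φ k * (c * c ^ (k - (n + 1))) :=
          mul_le_mul_of_nonneg_left h1 (hφpos k).le
      _ = c * φ k * c ^ (k - (n + 1)) := by ring

/-! ### Comparison with the function `ψ` -/

lemma superlinear_of_tendsto_div {ψ : ℕ → ℕ}
    (hψ : Filter.Tendsto (fun n : ℕ => (ψ n : ℝ) / n) Filter.atTop Filter.atTop) (M : ℝ) :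
    ∀ᶠ n : ℕ in Filter.atTop, M * n ≤ ψ n := by
  filter_upwards [hψ.eventually_ge_atTop M, Filter.eventually_gt_atTop 0] with n hn hn0
  rwa [le_div_iff₀ (by exact_mod_cast hn0)] at hn

/-- The finitely many zeros of `ψ` would make its minorants vanish, so they are replaced by `1`. -/
lemma eventually_max_one_eq {ψ : ℕ → ℕ}
    (hψ : Filter.Tendsto (fun n : ℕ => (ψ n : ℝ) / n) Filter.atTop Filter.atTop) :
    ∀ᶠ n : ℕ in Filter.atTop, max (ψ n : ℝ) 1 = ψ n := by
  filter_upwards [superlinear_of_tendsto_div hψ 1, Filter.eventually_ge_atTop 1] with n hn hn1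
  have : (1 : ℝ) ≤ n := by exact_mod_cast hn1
  exact max_eq_left (by linarith)

/-- The error in `abs_logSum_sub_le` is negligible compared with `ψ`. -/
lemma eventually_abs_logSum_sub_le {ψ : ℕ → ℕ}
    (hψ : Filter.Tendsto (fun n : ℕ => (ψ n : ℝ) / n) Filter.atTop Filter.atTop) {L : ℕ → ℝ}
    (hL : Monotone L) {x : ℝ} (hx : x ∈ digitSet (digitBound L)) {ε : ℝ} (hε : 0 < ε) :
    ∀ᶠ n : ℕ in Filter.atTop, 0 < (ψ n : ℝ) ∧ |logSum n x - L n| ≤ ε * ψ n := by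
  filter_upwards [superlinear_of_tendsto_div hψ ((1 + |L 0|) / ε), Filter.eventually_ge_atTop 1]
    with n hn hn1
  have h1 : (1 : ℝ) ≤ n := by exact_mod_cast hn1
  have h0 := abs_nonneg (L 0)
  have hpos : 0 < (1 + |L 0|) / ε * n := by positivity
  rw [div_mul_eq_mul_div] at hpos hn
  refine ⟨hpos.trans_le hn, (abs_logSum_sub_le hL hx n).trans ?_⟩
  rw [div_le_iff₀ hε] at hn
  nlinarith

lemma digitSet_subset_upperSet {ψ : ℕ → ℕ}
    (hψ : Filter.Tendsto (fun n : ℕ => (ψ n : ℝ) / n) Filter.atTop Filter.atTop) {L : ℕ → ℝ}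
    (hL : Monotone L) (hle : ∀ᶠ n in Filter.atTop, L n ≤ ψ n)
    (heq : ∃ᶠ n in Filter.atTop, L n = ψ n) : digitSet (digitBound L) ⊆ upperSet ψ := by
  intro x hx
  refine ⟨hx.1, hx.2.1, le_antisymm ?_ ?_⟩
  · refine EReal.le_of_forall_lt_iff_le.1 fun z hz => ?_
    have hz : 1 < z := by exact_mod_cast hz
    refine Filter.limsup_le_of_le (by isBoundedDefault) ?_
    filter_upwards [hle, eventually_abs_logSum_sub_le hψ hL hx (sub_pos.2 hz)] with n h1 h2
    rw [EReal.coe_le_coe_iff, div_le_iff₀ h2.1]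
    linarith [(abs_le.1 h2.2).2]
  · refine EReal.ge_of_forall_gt_iff_ge.1 fun z hz => ?_
    have hz : z < 1 := by exact_mod_cast hz
    refine Filter.le_limsup_of_frequently_le' ?_
    refine (heq.and_eventually (eventually_abs_logSum_sub_le hψ hL hx (sub_pos.2 hz))).mono ?_
    rintro n ⟨h1, h2⟩
    rw [EReal.coe_le_coe_iff, le_div_iff₀ h2.1]
    linarith [(abs_le.1 h2.2).1]

lemma digitSet_subset_lowerSet {ψ : ℕ → ℕ}
    (hψ : Filter.Tendsto (fun n : ℕ => (ψ n : ℝ) / n) Filter.atTop Filter.atTop) {L : ℕ → ℝ}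
    (hL : Monotone L) (hle : ∀ᶠ n in Filter.atTop, ψ n ≤ L n)
    (heq : ∃ᶠ n in Filter.atTop, L n = ψ n) : digitSet (digitBound L) ⊆ lowerSet ψ := by
  intro x hx
  refine ⟨hx.1, hx.2.1, le_antisymm ?_ ?_⟩
  · refine EReal.le_of_forall_lt_iff_le.1 fun z hz => ?_
    have hz : 1 < z := by exact_mod_cast hz
    refine Filter.liminf_le_of_frequently_le' ?_
    refine (heq.and_eventually (eventually_abs_logSum_sub_le hψ hL hx (sub_pos.2 hz))).mono ?_
    rintro n ⟨h1, h2⟩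
    rw [EReal.coe_le_coe_iff, div_le_iff₀ h2.1]
    linarith [(abs_le.1 h2.2).2]
  · refine EReal.ge_of_forall_gt_iff_ge.1 fun z hz => ?_
    have hz : z < 1 := by exact_mod_cast hz
    refine Filter.le_liminf_of_le (by isBoundedDefault) ?_
    filter_upwards [hle, eventually_abs_logSum_sub_le hψ hL hx (sub_pos.2 hz)] with n h1 h2
    rw [EReal.coe_le_coe_iff, le_div_iff₀ h2.1]
    linarith [(abs_le.1 h2.2).1]

lemma log_div_lt_log_iff {a c : ℝ} (ha : 0 < a) (hc : 0 < c) {n : ℕ} (hn : 0 < n) :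
    Real.log a / n < Real.log c ↔ a < c ^ n := by
  rw [div_lt_iff₀ (by exact_mod_cast hn), mul_comm, ← Real.log_pow,
    Real.log_lt_log_iff ha (by positivity)]

lemma log_lt_log_div_iff {a c : ℝ} (ha : 0 < a) (hc : 0 < c) {n : ℕ} (hn : 0 < n) :
    Real.log c < Real.log a / n ↔ c ^ n < a := by
  rw [lt_div_iff₀ (by exact_mod_cast hn), mul_comm, ← Real.log_pow,
    Real.log_lt_log_iff (by positivity) ha]

lemma eventually_pow_lt_of_lt_liminf {ψ : ℕ → ℕ}
    (hψ : Filter.Tendsto (fun n : ℕ => (ψ n : ℝ) / n) Filter.atTop Filter.atTop) {b : ENNReal}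
    (hb : Filter.liminf (fun n : ℕ => ((Real.log (ψ n : ℝ) / (n : ℝ) : ℝ) : EReal))
      Filter.atTop = ENNReal.log b) {c : ℝ} (hc : 0 < c) (hcb : ENNReal.ofReal c < b) :
    ∀ᶠ n in Filter.atTop, c ^ n < ψ n := by
  rw [← ENNReal.log_lt_log_iff, ENNReal.log_ofReal_of_pos hc, ← hb] at hcb
  filter_upwards [Filter.eventually_lt_of_lt_liminf hcb, eventually_max_one_eq hψ,
    Filter.eventually_gt_atTop 0] with n hn h1 hn0
  rw [EReal.coe_lt_coe_iff] at hn
  exact (log_lt_log_div_iff (zero_lt_one.trans_le (max_eq_left_iff.1 h1)) hc hn0).1 hn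

lemma frequently_pow_lt_of_lt_limsup {ψ : ℕ → ℕ}
    (hψ : Filter.Tendsto (fun n : ℕ => (ψ n : ℝ) / n) Filter.atTop Filter.atTop) {B : ENNReal}
    (hB : Filter.limsup (fun n : ℕ => ((Real.log (ψ n : ℝ) / (n : ℝ) : ℝ) : EReal))
      Filter.atTop = ENNReal.log B) {c : ℝ} (hc : 0 < c) (hcB : ENNReal.ofReal c < B) :
    ∃ᶠ n in Filter.atTop, c ^ n < ψ n := by
  rw [← ENNReal.log_lt_log_iff, ENNReal.log_ofReal_of_pos hc, ← hB] at hcB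
  refine ((Filter.frequently_lt_of_lt_limsup (by isBoundedDefault) hcB).and_eventually
    ((eventually_max_one_eq hψ).and (Filter.eventually_gt_atTop 0))).mono ?_
  rintro n ⟨hn, h1, hn0⟩
  rw [EReal.coe_lt_coe_iff] at hn
  exact (log_lt_log_div_iff (zero_lt_one.trans_le (max_eq_left_iff.1 h1)) hc hn0).1 hn

lemma frequently_lt_pow_of_liminf_lt {ψ : ℕ → ℕ}
    (hψ : Filter.Tendsto (fun n : ℕ => (ψ n : ℝ) / n) Filter.atTop Filter.atTop) {b : ENNReal}
    (hb : Filter.liminf (fun n : ℕ => ((Real.log (ψ n : ℝ) / (n : ℝ) : ℝ) : EReal))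
      Filter.atTop = ENNReal.log b) {c : ℝ} (hc : 0 < c) (hcb : b < ENNReal.ofReal c) :
    ∃ᶠ n in Filter.atTop, ψ n < c ^ n := by
  rw [← ENNReal.log_lt_log_iff, ENNReal.log_ofReal_of_pos hc, ← hb] at hcb
  refine ((Filter.frequently_lt_of_liminf_lt (by isBoundedDefault) hcb).and_eventually
    ((eventually_max_one_eq hψ).and (Filter.eventually_gt_atTop 0))).mono ?_
  rintro n ⟨hn, h1, hn0⟩
  rw [EReal.coe_lt_coe_iff] at hn
  exact (log_div_lt_log_iff (zero_lt_one.trans_le (max_eq_left_iff.1 h1)) hc hn0).1 hn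

lemma eventually_lt_pow_of_limsup_lt {ψ : ℕ → ℕ}
    (hψ : Filter.Tendsto (fun n : ℕ => (ψ n : ℝ) / n) Filter.atTop Filter.atTop) {B : ENNReal}
    (hB : Filter.limsup (fun n : ℕ => ((Real.log (ψ n : ℝ) / (n : ℝ) : ℝ) : EReal))
      Filter.atTop = ENNReal.log B) {c : ℝ} (hc : 0 < c) (hcB : B < ENNReal.ofReal c) :
    ∀ᶠ n in Filter.atTop, ψ n < c ^ n := by
  rw [← ENNReal.log_lt_log_iff, ENNReal.log_ofReal_of_pos hc, ← hB] at hcB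
  filter_upwards [Filter.eventually_lt_of_limsup_lt hcB, eventually_max_one_eq hψ,
    Filter.eventually_gt_atTop 0] with n hn h1 hn0
  rw [EReal.coe_lt_coe_iff] at hn
  exact (log_div_lt_log_iff (zero_lt_one.trans_le (max_eq_left_iff.1 h1)) hc hn0).1 hn

lemma exists_lt_of_frequently {c d : ℝ} (hc : 0 < c) (hcd : c < d) {f g : ℕ → ℝ}
    (h : ∃ᶠ n in Filter.atTop, d ^ n < f n ∧ 1 / 2 * f n < g n) (M : ℝ) :
    ∃ n, M * c ^ n < g n := by
  have h1 := tendsto_pow_atTop_atTop_of_one_lt ((one_lt_div hc).2 hcd)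
  obtain ⟨n, ⟨hn1, hn2⟩, hn3⟩ := (h.and_eventually (h1.eventually_ge_atTop (2 * M))).exists
  rw [div_pow, le_div_iff₀ (by positivity)] at hn3
  exact ⟨n, by linarith⟩

lemma upperSet_subset_unboundedSet {ψ : ℕ → ℕ} {c d : ℝ} (hc : 0 < c) (hcd : c < d)
    (hd : ∀ᶠ n in Filter.atTop, d ^ n < ψ n) : upperSet ψ ⊆ unboundedSet c := by
  rintro x ⟨hx, hirr, hlim⟩
  have hhalf : ((1 / 2 : ℝ) : EReal) <
      Filter.limsup (fun n : ℕ => ((logSum n x / (ψ n : ℝ) : ℝ) : EReal)) Filter.atTop := by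
    rw [hlim]
    exact_mod_cast (by norm_num : (1 / 2 : ℝ) < 1)
  refine ⟨hx, hirr, exists_lt_of_frequently (f := fun n => ψ n) hc hcd
    (((Filter.frequently_lt_of_lt_limsup (by isBoundedDefault) hhalf).and_eventually hd).mono ?_)⟩
  rintro n ⟨h1, h2⟩
  rw [EReal.coe_lt_coe_iff, lt_div_iff₀ ((pow_pos (hc.trans hcd) n).trans h2)] at h1
  exact ⟨h2, h1⟩

lemma lowerSet_subset_unboundedSet {ψ : ℕ → ℕ} {c d : ℝ} (hc : 0 < c) (hcd : c < d)
    (hd : ∃ᶠ n in Filter.atTop, d ^ n < ψ n) : lowerSet ψ ⊆ unboundedSet c := by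
  rintro x ⟨hx, hirr, hlim⟩
  have hhalf : ((1 / 2 : ℝ) : EReal) <
      Filter.liminf (fun n : ℕ => ((logSum n x / (ψ n : ℝ) : ℝ) : EReal)) Filter.atTop := by
    rw [hlim]
    exact_mod_cast (by norm_num : (1 / 2 : ℝ) < 1)
  refine ⟨hx, hirr, exists_lt_of_frequently (f := fun n => ψ n) hc hcd
    ((hd.and_eventually (Filter.eventually_lt_of_lt_liminf hhalf)).mono ?_)⟩
  rintro n ⟨h2, h1⟩
  rw [EReal.coe_lt_coe_iff, lt_div_iff₀ ((pow_pos (hc.trans hcd) n).trans h2)] at h1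
  exact ⟨h2, h1⟩

lemma continuous_inv_one_add : Continuous fun c : ENNReal => (1 + c)⁻¹ :=
  continuous_inv.comp (continuous_const_add 1)

lemma dimH_le_of_subset_unboundedSet {E : Set ℝ} {b : ENNReal} (hb1 : 1 < b)
    (h : ∀ c d : ℝ, 0 < c → c < d → ENNReal.ofReal d < b → E ⊆ unboundedSet c) :
    dimH E ≤ (1 + b)⁻¹ := by
  have := nhdsLT_neBot_of_exists_lt ⟨1, hb1⟩
  refine ge_of_tendsto (x := nhdsWithin b (Set.Iio b))
    ((continuous_inv_one_add.tendsto b).mono_left nhdsWithin_le_nhds) ?_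
  filter_upwards [Ioo_mem_nhdsLT hb1] with c hc
  lift c to NNReal using hc.2.ne_top
  obtain ⟨d, hcd, hdb⟩ := ENNReal.lt_iff_exists_nnreal_btwn.1 hc.2
  have hc1 : (1 : ℝ) < c := by exact_mod_cast hc.1
  have hsub := h c d (by linarith) (by exact_mod_cast hcd) (by rwa [ENNReal.ofReal_coe_nnreal])
  simpa using (dimH_mono hsub).trans (dimH_unboundedSet_le hc1)

lemma le_dimH_of_forall_gt {E : Set ℝ} {b : ENNReal} (hb1 : 1 < b)
    (h : ∀ c d : ℝ, 1 < c → c < d → b < ENNReal.ofReal c → (1 + ENNReal.ofReal d)⁻¹ ≤ dimH E) :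
    (1 + b)⁻¹ ≤ dimH E := by
  rcases eq_or_ne b ⊤ with rfl | hb
  · simp
  have := nhdsGT_neBot_of_exists_gt ⟨⊤, hb.lt_top⟩
  refine le_of_tendsto (x := nhdsWithin b (Set.Ioi b))
    ((continuous_inv_one_add.tendsto b).mono_left nhdsWithin_le_nhds) ?_
  filter_upwards [Ioo_mem_nhdsGT hb.lt_top] with d hd
  lift d to NNReal using hd.2.ne
  obtain ⟨c, hbc, hcd⟩ := ENNReal.lt_iff_exists_nnreal_btwn.1 hd.1
  have hc1 : (1 : ℝ) < c := by exact_mod_cast hb1.trans hbc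
  simpa using h c d hc1 (by exact_mod_cast hcd) (by rwa [ENNReal.ofReal_coe_nnreal])

lemma superlinear_max_one {ψ : ℕ → ℕ}
    (hψ : Filter.Tendsto (fun n : ℕ => (ψ n : ℝ) / n) Filter.atTop Filter.atTop) (M : ℝ) :
    ∀ᶠ n : ℕ in Filter.atTop, M * n ≤ max (ψ n : ℝ) 1 :=
  (superlinear_of_tendsto_div hψ M).mono fun _ hn => hn.trans (le_max_left _ _)

lemma upperSet_nonempty {ψ : ℕ → ℕ}
    (hψ : Filter.Tendsto (fun n : ℕ => (ψ n : ℝ) / n) Filter.atTop Filter.atTop) :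
    (upperSet ψ).Nonempty := by
  obtain ⟨L, hL, -, hle, heq⟩ := exists_monotone_minorant (φ := fun n => max (ψ n : ℝ) 1)
    (fun _ => le_max_right _ _) (superlinear_max_one hψ)
  have hev := eventually_max_one_eq hψ
  exact (digitSet_digitBound_nonempty hL).mono (digitSet_subset_upperSet hψ hL
    (hev.mono fun n hn => (hle n).trans hn.le)
    ((heq.and_eventually hev).mono fun n hn => hn.1.trans hn.2))

lemma lowerSet_nonempty {ψ : ℕ → ℕ}
    (hψ : Filter.Tendsto (fun n : ℕ => (ψ n : ℝ) / n) Filter.atTop Filter.atTop) :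
    (lowerSet ψ).Nonempty := by
  obtain ⟨L, hL, hle, heq⟩ := exists_monotone_majorant
    (tendsto_atTop_of_superlinear (superlinear_of_tendsto_div hψ))
  exact (digitSet_digitBound_nonempty hL).mono
    (digitSet_subset_lowerSet hψ hL (.of_forall hle) heq)

lemma le_dimH_upperSet {ψ : ℕ → ℕ}
    (hψ : Filter.Tendsto (fun n : ℕ => (ψ n : ℝ) / n) Filter.atTop Filter.atTop) {c d : ℝ}
    (hc : 1 < c) (hcd : c < d) (hψc : ∃ᶠ n in Filter.atTop, ψ n < c ^ n) :
    (1 + ENNReal.ofReal d)⁻¹ ≤ dimH (upperSet ψ) := by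
  have hd0 : 0 < d := by linarith
  have hlow : ∀ ε > 0, ∃ n, max (ψ n : ℝ) 1 < ε * d ^ n := by
    intro ε hε
    have h1 := tendsto_pow_atTop_atTop_of_one_lt ((one_lt_div (by linarith : 0 < c)).2 hcd)
    obtain ⟨n, hn1, hn2⟩ := (hψc.and_eventually (h1.eventually_gt_atTop ε⁻¹)).exists
    rw [div_pow, lt_div_iff₀ (by positivity), inv_mul_lt_iff₀ hε] at hn2
    exact ⟨n, max_lt (hn1.trans hn2) ((one_le_pow₀ hc.le).trans_lt hn2)⟩
  obtain ⟨L, hL, hgrow, hle, heq, hratio⟩ := exists_slow_minorant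
    (φ := fun n => max (ψ n : ℝ) 1) (fun _ => le_max_right _ _) (superlinear_max_one hψ)
    (hc.trans hcd) hlow
  have hev := eventually_max_one_eq hψ
  exact (le_dimH_digitSet_digitBound hL hgrow hd0 hratio).trans
    (dimH_mono (digitSet_subset_upperSet hψ hL (hev.mono fun n hn => (hle n).trans hn.le)
      ((heq.and_eventually hev).mono fun n hn => hn.1.trans hn.2)))

lemma le_dimH_lowerSet {ψ : ℕ → ℕ}
    (hψ : Filter.Tendsto (fun n : ℕ => (ψ n : ℝ) / n) Filter.atTop Filter.atTop) {c d : ℝ}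
    (hc : 1 < c) (hcd : c < d) (hψc : ∀ᶠ n in Filter.atTop, ψ n < c ^ n) :
    (1 + ENNReal.ofReal d)⁻¹ ≤ dimH (lowerSet ψ) := by
  have hd0 : 0 < d := by linarith
  have hup : Filter.Tendsto (fun n => d ^ n / max (ψ n : ℝ) 1) Filter.atTop Filter.atTop := by
    refine Filter.tendsto_atTop_mono' _ ?_
      (tendsto_pow_atTop_atTop_of_one_lt ((one_lt_div (by linarith : 0 < c)).2 hcd))
    filter_upwards [hψc] with n hn
    rw [div_pow]
    exact div_le_div_of_nonneg_left (by positivity) (by positivity)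
      (max_le hn.le (one_le_pow₀ hc.le))
  obtain ⟨L, hL, hle, heq, hratio⟩ := exists_slow_majorant
    (φ := fun n => max (ψ n : ℝ) 1) (fun _ => le_max_right _ _)
    (tendsto_atTop_of_superlinear (superlinear_max_one hψ)) (hc.trans hcd) hup
  have hev := eventually_max_one_eq hψ
  have hgrow : ∀ M : ℝ, ∀ᶠ n : ℕ in Filter.atTop, M * n ≤ L n := fun M =>
    (superlinear_max_one hψ M).mono fun n hn => hn.trans (hle n)
  exact (le_dimH_digitSet_digitBound hL hgrow hd0 hratio).trans
    (dimH_mono (digitSet_subset_lowerSet hψ hL (.of_forall fun n => (le_max_left _ _).trans (hle n))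
      ((heq.and_eventually hev).mono fun n hn => hn.1.trans hn.2)))

end FastKhintchine

end

theorem theorem1p2 (ψ : ℕ → ℕ)
    (hψ : Filter.Tendsto (fun n : ℕ => (ψ n : ℝ) / (n : ℝ)) Filter.atTop Filter.atTop)
    (b B : ENNReal)
    (hb : Filter.liminf (fun n : ℕ => ((Real.log (ψ n : ℝ) / (n : ℝ) : ℝ) : EReal))
      Filter.atTop = ENNReal.log b)
    (hB : Filter.limsup (fun n : ℕ => ((Real.log (ψ n : ℝ) / (n : ℝ) : ℝ) : EReal))
      Filter.atTop = ENNReal.log B)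
    (hb1 : 1 < b) (hB1 : 1 < B) :
    (dimH (FastKhintchine.upperSet ψ) = 1 / (1 + b) ∧
      dimH (FastKhintchine.lowerSet ψ) = 1 / (1 + B)) ∧
    (FastKhintchine.upperSet ψ).Nonempty ∧ (FastKhintchine.lowerSet ψ).Nonempty := by
  simp_rw [one_div]
  refine ⟨⟨le_antisymm ?_ ?_, le_antisymm ?_ ?_⟩, FastKhintchine.upperSet_nonempty hψ,
    FastKhintchine.lowerSet_nonempty hψ⟩
  · exact FastKhintchine.dimH_le_of_subset_unboundedSet hb1 fun c d hc hcd hdb =>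
      FastKhintchine.upperSet_subset_unboundedSet hc hcd
        (FastKhintchine.eventually_pow_lt_of_lt_liminf hψ hb (hc.trans hcd) hdb)
  · exact FastKhintchine.le_dimH_of_forall_gt hb1 fun c d hc hcd hbc =>
      FastKhintchine.le_dimH_upperSet hψ hc hcd
        (FastKhintchine.frequently_lt_pow_of_liminf_lt hψ hb (by linarith) hbc)
  · exact FastKhintchine.dimH_le_of_subset_unboundedSet hB1 fun c d hc hcd hdB =>
      FastKhintchine.lowerSet_subset_unboundedSet hc hcd
        (FastKhintchine.frequently_pow_lt_of_lt_limsup hψ hB (hc.trans hcd) hdB)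
  · exact FastKhintchine.le_dimH_of_forall_gt hB1 fun c d hc hcd hBc =>
      FastKhintchine.le_dimH_lowerSet hψ hc hcd
        (FastKhintchine.eventually_lt_pow_of_limsup_lt hψ hB (by linarith) hBc)
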